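/- Let $F_2$ be the free group on two generators $g_0,g_1$. For $G=\mathrm{SU}(2)$ or $G=\mathrm{SO}(3)$, topologize $\mathrm{Hom}(F_2,G)$ as $G^2$ via $h\mapsto(h(g_0),h(g_1))$, and give $H_G(F_2)=\mathrm{Hom}(F_2,G)/G$ (quotient by conjugation) the quotient topology; write $H(F_2)=H_{\mathrm{SO}(3)}(F_2)$. Let $p: H_{\mathrm{SU}(2)}(F_2)\to H(F_2)$ be the map induced by the double covering $\mathrm{SU}(2)\to\mathrm{SO}(3)$ (the action of $\mathrm{SU}(2)$ by conjugation on pure quaternions). Let the Klein four-group $V=\{\pm1\}^2$ act on $H_{\mathrm{SU}(2)}(F_2)$ by $(\varepsilon_0,\varepsilon_1)\cdot[h]=[h']$, where $h'(g_i)=\varepsilon_i h(g_i)$. Then: 1. There is a homeomorphism $\Phi$ from $H_{\mathrm{SU}(2)}(F_2)$ to the closed unit ball of $\mathbb R^3$ such that, for each $\chi\in H_{\mathrm{SU}(2)}(F_2)$, the following are equivalent: $\Phi(\chi)$ lies on the boundary sphere; $\chi$ is abelian, i.e. $\chi$ is the class of a representation with abelian image; $p(\chi)$ is the class of a representation $F_2\to\mathrm{SO}(3)$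 all of whose values are rotations about one common axis (that is, fix a common nonzero vector). 2. The map $p$ is a $4$-to-$1$ branched covering induced by the action of $V$. That is, $V$ acts by homeomorphisms, the fibres of $p$ are exactly the $V$-orbits, and $p$ is a continuous, open and closed surjection with at most $4$ points in each fibre; moreover, if $L\subset H(F_2)$ is the set of points with fewer than $4$ preimages, then $p$ is a covering map over $H(F_2)\setminus L$, and both $L$ and $p^{-1}(L)$ are closed and locally non-separating. (A closed subset $K$ of a space is locally non-separating if every neighbourhood of every point of the space contains a neighbourhood $W$ of that point such that $W\setminus K$ is nonempty and connected.) -/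

import Mathlib

open Topology

/-! ### Character spaces of the free group of rank two -/

/-- The free group of rank two; its two standard generators are `FreeGroup.of 0`, `FreeGroup.of 1`. -/
abbrev F2 : Type := FreeGroup (Fin 2)

/-- The representation space `Hom(F₂, G)`. -/
def RepSpace (G : Type*) [Group G] : Type _ := F2 →* G

namespace RepSpace

/-- The underlying homomorphism of a representation. -/
def hom {G : Type*} [Group G] (ρ : RepSpace G) : F2 →* G := ρ

/-- The values of a representation on the two generators. -/
def gens {G : Type*} [Group G] (ρ : RepSpace G) : Fin 2 → G := fun i => ρ.hom (FreeGroup.of i)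

/-- `Hom(F₂, G)` is topologized as a subspace of `G²` (evaluation on the generators). -/
instance instTopologicalSpaceRepSpace (G : Type*) [Group G] [TopologicalSpace G] :
    TopologicalSpace (RepSpace G) :=
  TopologicalSpace.induced gens inferInstance

/-- Two representations are equivalent when they are conjugate by an element of `G`. -/
instance conjSetoid (G : Type*) [Group G] : Setoid (RepSpace G) where
  r ρ σ := ∃ g : G, ∀ w : F2, σ.hom w = g * ρ.hom w * g⁻¹
  iseqv :=
    { refl := fun ρ => ⟨1, fun w => by simp⟩
      symm := by
        rintro ρ σ ⟨g, hg⟩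
        exact ⟨g⁻¹, fun w => by rw [hg w]; group⟩
      trans := by
        rintro ρ σ τ ⟨g, hg⟩ ⟨k, hk⟩
        exact ⟨k * g, fun w => by rw [hk w, hg w]; group⟩ }

end RepSpace

/-- The `G`-character space `Hom(F₂, G)/G` of `F₂`. -/
def CharSpace (G : Type*) [Group G] : Type _ := Quotient (RepSpace.conjSetoid G)

namespace CharSpace

/-- The character of a representation. -/
def mk {G : Type*} [Group G] (ρ : RepSpace G) : CharSpace G :=
  Quotient.mk (RepSpace.conjSetoid G) ρ

/-- The character space carries the quotient topology. -/
instance instTopologicalSpaceCharSpace (G : Type*) [Group G] [TopologicalSpace G] :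
    TopologicalSpace (CharSpace G) :=
  inferInstanceAs (TopologicalSpace (Quotient (RepSpace.conjSetoid G)))

/-- A character is abelian when it is the class of a representation with abelian image. -/
def IsAbelian {G : Type*} [Group G] (χ : CharSpace G) : Prop :=
  ∃ ρ : RepSpace G, mk ρ = χ ∧ ∀ v w : F2, Commute (ρ.hom v) (ρ.hom w)

/-- A homomorphism of groups induces a map of character spaces. -/
def map {G K : Type*} [Group G] [Group K] (f : G →* K) : CharSpace G → CharSpace K :=
  Quotient.map' (s₁ := RepSpace.conjSetoid G) (s₂ := RepSpace.conjSetoid K)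
    (fun ρ => (f.comp ρ.hom : F2 →* K)) (by
      rintro ρ σ ⟨g, hg⟩
      refine ⟨f g, fun w => ?_⟩
      change f (σ.hom w) = f g * f (ρ.hom w) * (f g)⁻¹
      rw [hg w]; simp)

end CharSpace

/-! ### The double covering `SU(2) → SO(3)` -/

/-- The group `SU(2)`. -/
abbrev SU2 : Type := Matrix.specialUnitaryGroup (Fin 2) ℂ

/-- The group `SO(3)`. -/
abbrev SO3 : Type := Matrix.specialOrthogonalGroup (Fin 3) ℝ

/-- The purely quaternionic matrix with coordinates `v = (β, γ, δ)`. -/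
def pureQuat (v : Fin 3 → ℝ) : Matrix (Fin 2) (Fin 2) ℂ :=
  !![Complex.I * v 0, v 1 + Complex.I * v 2; -v 1 + Complex.I * v 2, -(Complex.I * v 0)]

/-- The coordinates `(β, γ, δ)` of a purely quaternionic matrix. -/
def pureCoord (M : Matrix (Fin 2) (Fin 2) ℂ) : Fin 3 → ℝ :=
  ![(M 0 0).im, (M 0 1).re, (M 0 1).im]

/-- The matrix, in the coordinates `(β, γ, δ)`, of the map `Q ↦ A Q A*` on pure quaternions. -/
def adMatrix (A : Matrix (Fin 2) (Fin 2) ℂ) : Matrix (Fin 3) (Fin 3) ℝ :=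
  Matrix.of fun i j => pureCoord (A * pureQuat (Pi.single j 1) * A.conjTranspose) i

theorem SU2.exists_coords (A : SU2) : ∃ a b c d : ℝ, a ^ 2 + b ^ 2 + c ^ 2 + d ^ 2 = 1 ∧
    A.1 = !![⟨a, b⟩, ⟨c, d⟩; ⟨-c, d⟩, ⟨a, -b⟩] := by
  obtain ⟨A, hA⟩ := A
  obtain ⟨hU, hdet⟩ := Matrix.mem_specialUnitaryGroup_iff.1 hA
  have h1 : A * star A = 1 := Matrix.mem_unitaryGroup_iff.1 hU
  have h2 : star A = A.adjugate := by
    have h3 : A.adjugate * A = 1 := by rw [Matrix.adjugate_mul, hdet, one_smul]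
    calc star A = A.adjugate * A * star A := by rw [h3, one_mul]
      _ = A.adjugate := by rw [mul_assoc, h1, mul_one]
  rw [Matrix.adjugate_fin_two] at h2
  have h00 := congrFun (congrFun h2 0) 0
  have h01 := congrFun (congrFun h2 0) 1
  simp [Matrix.star_apply] at h00 h01
  have h11 : A 1 1 = ⟨(A 0 0).re, -(A 0 0).im⟩ := by
    rw [← h00]; rfl
  have h10 : A 1 0 = ⟨-(A 0 1).re, (A 0 1).im⟩ := by
    have : A 1 0 = star (-(A 0 1)) := by rw [← h01]; simp
    rw [this]; apply Complex.ext <;> simp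
  refine ⟨(A 0 0).re, (A 0 0).im, (A 0 1).re, (A 0 1).im, ?_, ?_⟩
  · rw [Matrix.det_fin_two, h11, h10] at hdet
    have := congrArg Complex.re hdet
    simp at this
    linarith
  · ext i j
    fin_cases i <;> fin_cases j <;> simp [h11, h10]

theorem adMatrix_coords (a b c d : ℝ) :
    adMatrix !![⟨a, b⟩, ⟨c, d⟩; ⟨-c, d⟩, ⟨a, -b⟩] =
      !![a ^ 2 + b ^ 2 - c ^ 2 - d ^ 2, 2 * (b * c - a * d), 2 * (b * d + a * c);
         2 * (b * c + a * d), a ^ 2 - b ^ 2 + c ^ 2 - d ^ 2, 2 * (c * d - a * b);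
         2 * (b * d - a * c), 2 * (c * d + a * b), a ^ 2 - b ^ 2 - c ^ 2 + d ^ 2] := by
  ext i j
  fin_cases i <;> fin_cases j <;>
    simp [adMatrix, pureCoord, pureQuat, Matrix.mul_apply, Fin.sum_univ_two] <;> ring

theorem adMatrix_mem (A : SU2) : adMatrix A.1 ∈ Matrix.specialOrthogonalGroup (Fin 3) ℝ := by
  obtain ⟨a, b, c, d, h, hA⟩ := SU2.exists_coords A
  rw [hA, adMatrix_coords, Matrix.mem_specialOrthogonalGroup_iff, Matrix.mem_orthogonalGroup_iff]
  constructor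
  · ext i j
    fin_cases i <;> fin_cases j <;>
      simp [Matrix.mul_apply, Fin.sum_univ_three] <;> try ring1
    all_goals
      linear_combination (a ^ 2 + b ^ 2 + c ^ 2 + d ^ 2 + 1) * h
  · rw [Matrix.det_fin_three]
    simp
    linear_combination ((a ^ 2 + b ^ 2 + c ^ 2 + d ^ 2) ^ 2 + (a ^ 2 + b ^ 2 + c ^ 2 + d ^ 2) + 1) * h

theorem adMatrix_mul (A B : SU2) : adMatrix (A.1 * B.1) = adMatrix A.1 * adMatrix B.1 := by
  obtain ⟨a, b, c, d, -, hA⟩ := SU2.exists_coords A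
  obtain ⟨p, q, r, s, -, hB⟩ := SU2.exists_coords B
  have hAB : A.1 * B.1 =
      !![⟨a * p - b * q - c * r - d * s, a * q + b * p + c * s - d * r⟩,
         ⟨a * r - b * s + c * p + d * q, a * s + b * r - c * q + d * p⟩;
         ⟨-(a * r - b * s + c * p + d * q), a * s + b * r - c * q + d * p⟩,
         ⟨a * p - b * q - c * r - d * s, -(a * q + b * p + c * s - d * r)⟩] := by
    rw [hA, hB]
    ext i j
    fin_cases i <;> fin_cases j <;> apply Complex.ext <;>
      simp [Matrix.mul_apply, Fin.sum_univ_two] <;> ring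
  rw [hAB, hA, hB, adMatrix_coords, adMatrix_coords, adMatrix_coords]
  ext i j
  fin_cases i <;> fin_cases j <;>
    simp [Matrix.mul_apply, Fin.sum_univ_three] <;> ring

/-- The covering homomorphism `SU(2) → SO(3)`: the action by conjugation on pure quaternions. -/
def covering : SU2 →* SO3 where
  toFun A := ⟨adMatrix A.1, adMatrix_mem A⟩
  map_one' := by
    apply Subtype.ext
    ext i j
    fin_cases i <;> fin_cases j <;> simp [adMatrix, pureCoord, pureQuat]
  map_mul' A B := Subtype.ext (adMatrix_mul A B)

/-- The natural map `Hom(F₂, SU(2))/SU(2) → Hom(F₂, SO(3))/SO(3)`. -/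
def toSO3Char : CharSpace SU2 → CharSpace SO3 := CharSpace.map covering

/-- An `SO(3)`-character all of whose values are rotations about one common axis. -/
def HasCommonAxis (χ : CharSpace SO3) : Prop :=
  ∃ ρ : RepSpace SO3, CharSpace.mk ρ = χ ∧
    ∃ v : Fin 3 → ℝ, v ≠ 0 ∧ ∀ w : F2, (ρ.hom w).1.mulVec v = v

/-! ### The Klein four-group action on the `SU(2)`-character space -/

/-- The Klein four-group, as the group of pairs of signs. -/
abbrev KleinV : Type := Fin 2 → ℤˣ

/-- The scalar matrix `±1` in `SU(2)`. -/
def signSU2 : ℤˣ →* SU2 where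
  toFun e := ⟨((e : ℤ) : ℂ) • (1 : Matrix (Fin 2) (Fin 2) ℂ), by
    rw [Matrix.mem_specialUnitaryGroup_iff, Matrix.mem_unitaryGroup_iff]
    rcases Int.units_eq_one_or e with rfl | rfl <;> simp [Matrix.det_neg]⟩
  map_one' := by apply Subtype.ext; simp
  map_mul' e f := by
    apply Subtype.ext
    rcases Int.units_eq_one_or e with rfl | rfl <;> simp

theorem signSU2_comm (e : ℤˣ) (A : SU2) : signSU2 e * A = A * signSU2 e := by
  apply Subtype.ext
  simp [signSU2]

/-- The pair of signs `(e₀, e₁)` sends a representation `ρ` to the representation with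
`g₀ ↦ e₀ ρ(g₀)`, `g₁ ↦ e₁ ρ(g₁)`. -/
def signTwist (e : KleinV) (ρ : RepSpace SU2) : RepSpace SU2 :=
  (FreeGroup.lift (fun i => signSU2 (e i) * ρ.gens i) : F2 →* SU2)

/-- The Klein four-group acts on the `SU(2)`-character space by sign changes at the generators. -/
instance instMulActionKleinV : MulAction KleinV (CharSpace SU2) where
  smul e := Quotient.map' (s₁ := RepSpace.conjSetoid SU2) (s₂ := RepSpace.conjSetoid SU2)
    (signTwist e) (by
      rintro ρ σ ⟨g, hg⟩
      refine ⟨g, fun w => ?_⟩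
      have h : (signTwist e σ).hom = (MulAut.conj g).toMonoidHom.comp (signTwist e ρ).hom := by
        apply FreeGroup.ext_hom
        intro i
        change FreeGroup.lift _ (FreeGroup.of i) = g * FreeGroup.lift _ (FreeGroup.of i) * g⁻¹
        rw [FreeGroup.lift_apply_of, FreeGroup.lift_apply_of]
        change signSU2 (e i) * σ.hom (FreeGroup.of i) = g * (signSU2 (e i) * ρ.hom (FreeGroup.of i)) * g⁻¹
        rw [hg, ← mul_assoc g, ← signSU2_comm]
        group
      rw [h]; rfl)
  one_smul χ := by
    induction χ using Quotient.inductionOn' with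
    | h ρ =>
      change CharSpace.mk (signTwist 1 ρ) = CharSpace.mk ρ
      congr 1
      apply FreeGroup.ext_hom
      intro i
      change FreeGroup.lift _ (FreeGroup.of i) = ρ.hom (FreeGroup.of i)
      rw [FreeGroup.lift_apply_of]
      simp [RepSpace.gens]
  mul_smul e f χ := by
    induction χ using Quotient.inductionOn' with
    | h ρ =>
      change CharSpace.mk (signTwist (e * f) ρ) = CharSpace.mk (signTwist e (signTwist f ρ))
      congr 1
      apply FreeGroup.ext_hom
      intro i
      change FreeGroup.lift _ (FreeGroup.of i) = FreeGroup.lift _ (FreeGroup.of i)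
      rw [FreeGroup.lift_apply_of, FreeGroup.lift_apply_of]
      change _ = _ * FreeGroup.lift _ (FreeGroup.of i)
      rw [FreeGroup.lift_apply_of]
      simp [mul_assoc]

/-! ### Branched coverings -/

/-- The branch locus of an `n`-to-one branched covering: the points with fewer than `n` preimages. -/
def branchLocus {X Y : Type*} (n : ℕ) (p : X → Y) : Set Y :=
  {y | (p ⁻¹' {y}).encard < n}

/-- A closed set is locally non-separating when each point of the space has arbitrarily small
neighbourhoods which remain connected and nonempty after removal of the set. This is the
topological form of `nowhere dense and of codimension at least two`. -/
def LocallyNonseparating {X : Type*} [TopologicalSpace X] (L : Set X) : Prop :=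
  IsClosed L ∧ ∀ x : X, ∀ U ∈ 𝓝 x, ∃ W ∈ 𝓝 x, W ⊆ U ∧ IsConnected (W \ L)

/-- `p` is an `n`-to-one branched covering: an open and closed continuous surjection whose fibres
have at most `n` points, and which is an `n`-sheeted covering outside a branch locus that, as well
as its preimage, is locally non-separating. -/
structure IsBranchedCovering {X Y : Type*} [TopologicalSpace X] [TopologicalSpace Y]
    (n : ℕ) (p : X → Y) : Prop where
  continuous : Continuous p
  surjective : Function.Surjective p
  isOpenMap : IsOpenMap p
  isClosedMap : IsClosedMap p
  encard_le : ∀ y, (p ⁻¹' {y}).encard ≤ n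
  isCoveringMapOn : IsCoveringMapOn p (branchLocus n p)ᶜ
  nonseparating_base : LocallyNonseparating (branchLocus n p)
  nonseparating_total : LocallyNonseparating (p ⁻¹' branchLocus n p)

/-! A representation of the free group in `SU2` is a pair of unit quaternions (A, B). Rotating Im A
onto the first imaginary axis and then Im B into a half-plane leaves a normal form depending only on
x = Re A, y = Re B, z = Re AB, so these three numbers classify pairs up to conjugation
(`exists_conj_pair`). By Cauchy–Schwarz for Im A and Im B they satisfy x², y² ≤ 1 and (z − xy)² ≤ (1
− x²)(1 − y²), and every such triple occurs (`exists_pair`). These inequalities say that the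
symmetric matrix with unit diagonal and off-diagonal entries x, y, z is positive semidefinite. They
cut out a compact convex body with interior, hence a ball, and the compact character space maps
homeomorphically onto it. The frontier is equality in Cauchy–Schwarz: Im A and Im B are parallel, A
and B commute, their rotations share an axis.

Two characters agree in `SO3` exactly when they differ by signs on the generators
(`toSO3Char_eq_iff`). In the coordinates (x, y, z) the signs act as diag(ε₀, ε₁, ε₀ε₁), so each
nontrivial element is a half-turn about a coordinate axis and fibres drop below four points exactly
over the axes. Removing the axes from a convex set with interior keeps it connected, which gives
local non-separation upstairs; openness of the quotient map carries it downstairs. Off the axes the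
finite group acts freely, whence the covering. -/

/-! ### Quaternionic coordinates on `SU(2)` -/

namespace SU2

/-- The real quaternionic coordinate. -/
def qa (A : SU2) : ℝ := (A.1 0 0).re
/-- The first imaginary quaternionic coordinate. -/
def qb (A : SU2) : ℝ := (A.1 0 0).im
/-- The second imaginary quaternionic coordinate. -/
def qc (A : SU2) : ℝ := (A.1 0 1).re
/-- The third imaginary quaternionic coordinate. -/
def qd (A : SU2) : ℝ := (A.1 0 1).im

theorem coe_eq (A : SU2) :
    A.1 = !![⟨qa A, qb A⟩, ⟨qc A, qd A⟩; ⟨-qc A, qd A⟩, ⟨qa A, -qb A⟩] := by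
  obtain ⟨a, b, c, d, -, h⟩ := exists_coords A
  simp [qa, qb, qc, qd, h]

theorem norm_coords (A : SU2) : qa A ^ 2 + qb A ^ 2 + qc A ^ 2 + qd A ^ 2 = 1 := by
  obtain ⟨a, b, c, d, h1, h⟩ := exists_coords A
  simpa [qa, qb, qc, qd, h] using h1

theorem ext_coords {A B : SU2} (ha : qa A = qa B) (hb : qb A = qb B) (hc : qc A = qc B)
    (hd : qd A = qd B) : A = B := by
  apply Subtype.ext
  rw [coe_eq A, coe_eq B, ha, hb, hc, hd]

/-- The element of `SU(2)` with given quaternionic coordinates. -/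
def ofCoords (a b c d : ℝ) (h : a ^ 2 + b ^ 2 + c ^ 2 + d ^ 2 = 1) : SU2 :=
  ⟨!![⟨a, b⟩, ⟨c, d⟩; ⟨-c, d⟩, ⟨a, -b⟩], by
    rw [Matrix.mem_specialUnitaryGroup_iff, Matrix.mem_unitaryGroup_iff]
    constructor
    · ext i j
      fin_cases i <;> fin_cases j <;> apply Complex.ext <;>
        simp [Matrix.mul_apply, Fin.sum_univ_two, Matrix.star_apply] <;> linarith
    · rw [Matrix.det_fin_two]
      apply Complex.ext <;> simp <;> linarith⟩

section

variable (a b c d : ℝ) (h : a ^ 2 + b ^ 2 + c ^ 2 + d ^ 2 = 1)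

@[simp] theorem qa_ofCoords : qa (ofCoords a b c d h) = a := rfl
@[simp] theorem qb_ofCoords : qb (ofCoords a b c d h) = b := rfl
@[simp] theorem qc_ofCoords : qc (ofCoords a b c d h) = c := rfl
@[simp] theorem qd_ofCoords : qd (ofCoords a b c d h) = d := rfl

end

variable (A B : SU2)

theorem qa_mul : qa (A * B) = qa A * qa B - qb A * qb B - qc A * qc B - qd A * qd B := by
  change ((A.1 * B.1) 0 0).re = _
  rw [coe_eq A, coe_eq B]
  simp [Matrix.mul_apply, Fin.sum_univ_two]
  ring

theorem qb_mul : qb (A * B) = qa A * qb B + qb A * qa B + qc A * qd B - qd A * qc B := by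
  change ((A.1 * B.1) 0 0).im = _
  rw [coe_eq A, coe_eq B]
  simp [Matrix.mul_apply, Fin.sum_univ_two]
  ring

theorem qc_mul : qc (A * B) = qa A * qc B - qb A * qd B + qc A * qa B + qd A * qb B := by
  change ((A.1 * B.1) 0 1).re = _
  rw [coe_eq A, coe_eq B]
  simp [Matrix.mul_apply, Fin.sum_univ_two]
  ring

theorem qd_mul : qd (A * B) = qa A * qd B + qb A * qc B - qc A * qb B + qd A * qa B := by
  change ((A.1 * B.1) 0 1).im = _
  rw [coe_eq A, coe_eq B]
  simp [Matrix.mul_apply, Fin.sum_univ_two]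
  ring

theorem inv_eq_ofCoords : A⁻¹ = ofCoords (qa A) (-qb A) (-qc A) (-qd A)
    (by rw [← norm_coords A]; ring) := by
  apply Subtype.ext
  change star A.1 = _
  rw [coe_eq A]
  ext i j
  fin_cases i <;> fin_cases j <;> apply Complex.ext <;> simp [Matrix.star_apply, ofCoords]

@[simp] theorem qa_inv : qa A⁻¹ = qa A := by rw [inv_eq_ofCoords]; rfl
@[simp] theorem qb_inv : qb A⁻¹ = -qb A := by rw [inv_eq_ofCoords]; rfl
@[simp] theorem qc_inv : qc A⁻¹ = -qc A := by rw [inv_eq_ofCoords]; rfl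
@[simp] theorem qd_inv : qd A⁻¹ = -qd A := by rw [inv_eq_ofCoords]; rfl

theorem qa_conj : qa (A * B * A⁻¹) = qa B := by
  simp only [qa_mul, qb_mul, qc_mul, qd_mul, qa_inv, qb_inv, qc_inv, qd_inv]
  linear_combination qa B * norm_coords A

/-- The imaginary part of a unit quaternion. -/
def vec (A : SU2) : Fin 3 → ℝ := ![qb A, qc A, qd A]

theorem covering_coe : (covering A).1 =
    !![qa A ^ 2 + qb A ^ 2 - qc A ^ 2 - qd A ^ 2, 2 * (qb A * qc A - qa A * qd A),
        2 * (qb A * qd A + qa A * qc A);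
      2 * (qb A * qc A + qa A * qd A), qa A ^ 2 - qb A ^ 2 + qc A ^ 2 - qd A ^ 2,
        2 * (qc A * qd A - qa A * qb A);
      2 * (qb A * qd A - qa A * qc A), 2 * (qc A * qd A + qa A * qb A),
        qa A ^ 2 - qb A ^ 2 - qc A ^ 2 + qd A ^ 2] := by
  change adMatrix A.1 = _
  rw [coe_eq A, adMatrix_coords]

/-- Links the two languages: statements about rotations of vectors become statements about
conjugation of quaternions. -/
theorem vec_conj : vec (A * B * A⁻¹) = (covering A).1.mulVec (vec B) := by
  rw [covering_coe]
  ext i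
  fin_cases i <;>
    simp [vec, Matrix.mulVec, dotProduct, Fin.sum_univ_three, qa_mul, qb_mul, qc_mul, qd_mul] <;>
    ring

/-! ### Commuting pairs: cross products, the Gram determinant and common axes. -/

variable {A B}

theorem eq_of_qa_of_vec (ha : qa A = qa B) (hv : vec A = vec B) : A = B :=
  ext_coords ha (congrFun hv 0) (congrFun hv 1) (congrFun hv 2)

/-- The commutator AB − BA is twice the cross product of the imaginary parts. -/
theorem commute_iff_cross : Commute A B ↔
    qc A * qd B - qd A * qc B = 0 ∧ qd A * qb B - qb A * qd B = 0 ∧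
      qb A * qc B - qc A * qb B = 0 := by
  constructor
  · intro h
    have hb := congrArg qb h.eq
    have hc := congrArg qc h.eq
    have hd := congrArg qd h.eq
    rw [qb_mul, qb_mul] at hb
    rw [qc_mul, qc_mul] at hc
    rw [qd_mul, qd_mul] at hd
    refine ⟨?_, ?_, ?_⟩ <;> linarith
  · rintro ⟨h1, h2, h3⟩
    apply ext_coords
    · rw [qa_mul, qa_mul]; ring
    · rw [qb_mul, qb_mul]; linear_combination 2 * h1
    · rw [qc_mul, qc_mul]; linear_combination 2 * h2
    · rw [qd_mul, qd_mul]; linear_combination 2 * h3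

/-- The Gram identity: the squared norm of the cross product of the imaginary parts. -/
theorem gram_identity (A B : SU2) :
    (1 - qa A ^ 2) * (1 - qa B ^ 2) - (qa (A * B) - qa A * qa B) ^ 2 =
      (qc A * qd B - qd A * qc B) ^ 2 + (qd A * qb B - qb A * qd B) ^ 2 +
        (qb A * qc B - qc A * qb B) ^ 2 := by
  have hA : 1 - qa A ^ 2 = qb A ^ 2 + qc A ^ 2 + qd A ^ 2 := by linarith [norm_coords A]
  have hB : 1 - qa B ^ 2 = qb B ^ 2 + qc B ^ 2 + qd B ^ 2 := by linarith [norm_coords B]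
  rw [hA, hB, qa_mul]
  ring

/-- By `gram_identity` the Cauchy–Schwarz defect is the squared norm of the cross product, so
equality means that the latter vanishes. -/
theorem commute_iff_gram : Commute A B ↔
    (qa (A * B) - qa A * qa B) ^ 2 = (1 - qa A ^ 2) * (1 - qa B ^ 2) := by
  rw [commute_iff_cross]
  have h := gram_identity A B
  constructor
  · rintro ⟨h1, h2, h3⟩
    rw [h1, h2, h3] at h
    linarith
  · intro h'
    rw [h', sub_self] at h
    refine ⟨?_, ?_, ?_⟩ <;> refine pow_eq_zero_iff (two_ne_zero) |>.1 ?_ <;> nlinarith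

/-- Every nonzero quaternion can be rescaled to lie in `SU(2)`. -/
theorem exists_rescale {a b c d : ℝ} (h : 0 < a ^ 2 + b ^ 2 + c ^ 2 + d ^ 2) :
    ∃ (g : SU2) (k : ℝ), 0 < k ∧ qa g = k * a ∧ qb g = k * b ∧ qc g = k * c ∧ qd g = k * d := by
  set n := a ^ 2 + b ^ 2 + c ^ 2 + d ^ 2 with hn
  have hk : (√n)⁻¹ ^ 2 * n = 1 := by
    rw [inv_pow, Real.sq_sqrt h.le, inv_mul_cancel₀ h.ne']
  exact ⟨ofCoords ((√n)⁻¹ * a) ((√n)⁻¹ * b) ((√n)⁻¹ * c) ((√n)⁻¹ * d)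
    (by rw [← hk, hn]; ring), (√n)⁻¹, by positivity, rfl, rfl, rfl, rfl⟩

/-- A quaternion commuting with a pure unit quaternion has parallel imaginary part. -/
theorem exists_smul_of_commute_pure {W : SU2} (hW : qa W = 0) (hA : Commute A W) :
    ∃ t : ℝ, qb A = t * qb W ∧ qc A = t * qc W ∧ qd A = t * qd W := by
  rw [commute_iff_cross] at hA
  obtain ⟨h1, h2, h3⟩ := hA
  have hn := norm_coords W
  rw [hW] at hn
  refine ⟨qb A * qb W + qc A * qc W + qd A * qd W, ?_, ?_, ?_⟩
  · linear_combination -qb A * hn + qc W * h3 - qd W * h2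
  · linear_combination -qc A * hn + qd W * h1 - qb W * h3
  · linear_combination -qd A * hn + qb W * h2 - qc W * h1

theorem commute_of_commute_pure {W : SU2} (hW : qa W = 0) (hA : Commute A W) (hB : Commute B W) :
    Commute A B := by
  obtain ⟨s, h1, h2, h3⟩ := exists_smul_of_commute_pure hW hA
  obtain ⟨t, k1, k2, k3⟩ := exists_smul_of_commute_pure hW hB
  rw [commute_iff_cross, h1, h2, h3, k1, k2, k3]
  refine ⟨?_, ?_, ?_⟩ <;> ring

/-- The common axis is the direction of Im A, or of Im B when A = ±1, and is arbitrary when both are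
±1. -/
theorem exists_pure_commute (h : Commute A B) :
    ∃ W : SU2, qa W = 0 ∧ Commute A W ∧ Commute B W := by
  by_cases hA : 0 < 0 ^ 2 + qb A ^ 2 + qc A ^ 2 + qd A ^ 2
  · obtain ⟨W, k, -, ha, hb, hc, hd⟩ := exists_rescale hA
    rw [commute_iff_cross] at h
    obtain ⟨h1, h2, h3⟩ := h
    refine ⟨W, by simpa using ha, ?_, ?_⟩ <;> rw [commute_iff_cross, hb, hc, hd]
    · refine ⟨?_, ?_, ?_⟩ <;> ring
    · refine ⟨?_, ?_, ?_⟩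
      · linear_combination -k * h1
      · linear_combination -k * h2
      · linear_combination -k * h3
  · have hb : qb A = 0 := by nlinarith [sq_nonneg (qc A), sq_nonneg (qd A)]
    have hc : qc A = 0 := by nlinarith [sq_nonneg (qb A), sq_nonneg (qd A)]
    have hd : qd A = 0 := by nlinarith [sq_nonneg (qc A), sq_nonneg (qb A)]
    have hAW (W : SU2) : Commute A W := by
      rw [commute_iff_cross, hb, hc, hd]
      simp
    by_cases hB : 0 < 0 ^ 2 + qb B ^ 2 + qc B ^ 2 + qd B ^ 2
    · obtain ⟨W, k, -, ha, hb, hc, hd⟩ := exists_rescale hB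
      refine ⟨W, by simpa using ha, hAW W, ?_⟩
      rw [commute_iff_cross, hb, hc, hd]
      refine ⟨?_, ?_, ?_⟩ <;> ring
    · have hb : qb B = 0 := by nlinarith [sq_nonneg (qc B), sq_nonneg (qd B)]
      have hc : qc B = 0 := by nlinarith [sq_nonneg (qb B), sq_nonneg (qd B)]
      have hd : qd B = 0 := by nlinarith [sq_nonneg (qc B), sq_nonneg (qb B)]
      refine ⟨ofCoords 0 1 0 0 (by norm_num), rfl, hAW _, ?_⟩
      rw [commute_iff_cross, hb, hc, hd]
      simp

/-- Conjugation always preserves the real part, so fixing the imaginary part of W amounts to fixing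
W. -/
theorem covering_mulVec_eq_iff {W : SU2} :
    (covering A).1.mulVec (vec W) = vec W ↔ Commute A W := by
  rw [← vec_conj, Commute, SemiconjBy, ← mul_inv_eq_iff_eq_mul]
  exact ⟨fun h => eq_of_qa_of_vec (qa_conj _ _) h, fun h => by rw [h]⟩

/-- A nonzero vector is a multiple of the imaginary part of a pure unit quaternion. -/
theorem exists_pure_vec {v : Fin 3 → ℝ} (hv : v ≠ 0) :
    ∃ (W : SU2) (k : ℝ), 0 < k ∧ qa W = 0 ∧ vec W = k • v := by
  have h : 0 < 0 ^ 2 + v 0 ^ 2 + v 1 ^ 2 + v 2 ^ 2 := by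
    by_contra h
    apply hv
    ext i
    fin_cases i <;> simp <;> nlinarith [sq_nonneg (v 0), sq_nonneg (v 1), sq_nonneg (v 2)]
  obtain ⟨W, k, hk, ha, hb, hc, hd⟩ := exists_rescale h
  refine ⟨W, k, hk, by simpa using ha, ?_⟩
  ext i
  fin_cases i <;> simp [vec, hb, hc, hd]

theorem vec_ne_zero {W : SU2} (hW : qa W = 0) : vec W ≠ 0 := by
  intro h
  have h0 : qb W = 0 := congrFun h 0
  have h1 : qc W = 0 := congrFun h 1
  have h2 : qd W = 0 := congrFun h 2
  have := norm_coords W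
  simp [hW, h0, h1, h2] at this

/-- Commuting pairs in `SU(2)` are those whose images in `SO(3)` have a common axis. -/
theorem commute_iff_exists_axis : Commute A B ↔
    ∃ v : Fin 3 → ℝ, v ≠ 0 ∧ (covering A).1.mulVec v = v ∧ (covering B).1.mulVec v = v := by
  constructor
  · intro h
    obtain ⟨W, hW, hA, hB⟩ := exists_pure_commute h
    exact ⟨vec W, vec_ne_zero hW, covering_mulVec_eq_iff.2 hA,
      covering_mulVec_eq_iff.2 hB⟩
  · rintro ⟨v, hv, hA, hB⟩
    obtain ⟨W, k, -, hW, hWv⟩ := exists_pure_vec hv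
    refine commute_of_commute_pure hW ?_ ?_
    · rw [← covering_mulVec_eq_iff, hWv, Matrix.mulVec_smul, hA]
    · rw [← covering_mulVec_eq_iff, hWv, Matrix.mulVec_smul, hB]

end SU2

namespace SU2

/-! ### Normal forms under conjugation -/

variable {A B : SU2}

theorem conj_eq_of_mul_eq {g N : SU2} (h : g * A = N * g) : g * A * g⁻¹ = N :=
  mul_inv_eq_iff_eq_mul.2 h

/-- Unit quaternions with the same real part are conjugate; when the imaginary parts are opposite
the conjugating element is taken to be a pure quaternion orthogonal to both. -/
theorem exists_conj_eq (N E : SU2) (ha : qa A = qa N) (hE : qa E = 0)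
    (hE' : qb N * qb E + qc N * qc E + qd N * qd E = 0) : ∃ g : SU2, g * A * g⁻¹ = N := by
  have hA := norm_coords A
  have hN := norm_coords N
  rw [← ha] at hN
  -- The half-turn about the bisector Im A + Im N exchanges the two imaginary parts. If the bisector
  -- vanishes, the half-turn about E, orthogonal to Im N, does.
  by_cases h : 0 < 0 ^ 2 + (qb A + qb N) ^ 2 + (qc A + qc N) ^ 2 + (qd A + qd N) ^ 2
  · obtain ⟨g, k, -, ga, gb, gc, gd⟩ := exists_rescale h
    refine ⟨g, conj_eq_of_mul_eq (ext_coords ?_ ?_ ?_ ?_)⟩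
    · rw [qa_mul, qa_mul, ga, gb, gc, gd, ← ha]
      linear_combination k * (hN - hA)
    · rw [qb_mul, qb_mul, ga, gb, gc, gd, ← ha]
      ring
    · rw [qc_mul, qc_mul, ga, gb, gc, gd, ← ha]
      ring
    · rw [qd_mul, qd_mul, ga, gb, gc, gd, ← ha]
      ring
  · have hb : qb A = -qb N := by
      nlinarith [sq_nonneg (qb A + qb N), sq_nonneg (qc A + qc N), sq_nonneg (qd A + qd N)]
    have hc : qc A = -qc N := by
      nlinarith [sq_nonneg (qb A + qb N), sq_nonneg (qc A + qc N), sq_nonneg (qd A + qd N)]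
    have hd : qd A = -qd N := by
      nlinarith [sq_nonneg (qb A + qb N), sq_nonneg (qc A + qc N), sq_nonneg (qd A + qd N)]
    refine ⟨E, conj_eq_of_mul_eq (ext_coords ?_ ?_ ?_ ?_)⟩
    · rw [qa_mul, qa_mul, hE, hb, hc, hd, ← ha]
      linear_combination 2 * hE'
    · rw [qb_mul, qb_mul, hE, hb, hc, hd, ← ha]
      ring
    · rw [qc_mul, qc_mul, hE, hb, hc, hd, ← ha]
      ring
    · rw [qd_mul, qd_mul, hE, hb, hc, hd, ← ha]
      ring

/-- A unit quaternion can be rotated around the first imaginary axis into the half-plane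
`qd = 0`, `0 ≤ qc`. -/
theorem exists_conj_halfplane (B : SU2) : ∃ g : SU2, qc g = 0 ∧ qd g = 0 ∧
    qb (g * B * g⁻¹) = qb B ∧ 0 ≤ qc (g * B * g⁻¹) ∧ qd (g * B * g⁻¹) = 0 := by
  set r := √(qc B ^ 2 + qd B ^ 2) with hr
  have hr2 : r ^ 2 = qc B ^ 2 + qd B ^ 2 := Real.sq_sqrt (by positivity)
  have hr0 : 0 ≤ r := Real.sqrt_nonneg _
  have hB := norm_coords B
  let N : SU2 := ofCoords (qa B) (qb B) r 0 (by rw [hr2]; linarith)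
  suffices h : ∃ g : SU2, qc g = 0 ∧ qd g = 0 ∧ g * B = N * g by
    obtain ⟨g, h1, h2, h3⟩ := h
    refine ⟨g, h1, h2, ?_⟩
    rw [conj_eq_of_mul_eq h3]
    exact ⟨rfl, hr0, rfl⟩
  -- With u = qc B + i qd B, conjugation by a unit g = a + bi multiplies u by g². The choice g ∝ r +
  -- ū works because (r + ū)²u is a nonnegative real. If r + ū = 0, then u = −r and g = i serves.
  by_cases h : 0 < (r + qc B) ^ 2 + (-qd B) ^ 2 + 0 ^ 2 + 0 ^ 2
  · obtain ⟨g, k, -, ga, gb, gc, gd⟩ := exists_rescale h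
    refine ⟨g, by simpa using gc, by simpa using gd, ext_coords ?_ ?_ ?_ ?_⟩
    · rw [qa_mul, qa_mul, ga, gb, gc, gd]
      simp [N]; ring
    · rw [qb_mul, qb_mul, ga, gb, gc, gd]
      simp [N]; ring
    · rw [qc_mul, qc_mul, ga, gb, gc, gd]
      simp [N]; linear_combination -k * hr2
    · rw [qd_mul, qd_mul, ga, gb, gc, gd]
      simp [N]; ring
  · have hc : qc B = -r := by nlinarith [sq_nonneg (r + qc B), sq_nonneg (qd B)]
    have hd : qd B = 0 := by nlinarith [sq_nonneg (r + qc B), sq_nonneg (qd B)]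
    refine ⟨ofCoords 0 1 0 0 (by norm_num), rfl, rfl, ext_coords ?_ ?_ ?_ ?_⟩ <;>
      simp [N, qa_mul, qb_mul, qc_mul, qd_mul, hc, hd]

/-- The normal form of a pair in `SU(2)` in terms of `(Re A, Re B, Re AB)`. -/
structure IsNormalPair (x y z : ℝ) (A B : SU2) : Prop where
  qa_fst : qa A = x
  qb_fst : qb A = √(1 - x ^ 2)
  qc_fst : qc A = 0
  qd_fst : qd A = 0
  qa_snd : qa B = y
  qb_snd : qb B = (x * y - z) / √(1 - x ^ 2)
  qc_snd : qc B = √(1 - y ^ 2 - ((x * y - z) / √(1 - x ^ 2)) ^ 2)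
  qd_snd : qd B = 0

theorem IsNormalPair.unique {x y z : ℝ} {A B A' B' : SU2} (h : IsNormalPair x y z A B)
    (h' : IsNormalPair x y z A' B') : A = A' ∧ B = B' :=
  ⟨ext_coords (h.1.trans h'.1.symm) (h.2.trans h'.2.symm) (h.3.trans h'.3.symm)
    (h.4.trans h'.4.symm), ext_coords (h.5.trans h'.5.symm) (h.6.trans h'.6.symm)
    (h.7.trans h'.7.symm) (h.8.trans h'.8.symm)⟩

/-- Here Re AB = Re A · Re B − `qb A` · `qb B`, which gives `qb B` by division. When A = ±1 the
quotient is 0 by convention, and the last hypothesis makes this the right value. -/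
theorem isNormalPair_of_coords (hA : 0 ≤ qb A) (hA1 : qc A = 0) (hA2 : qd A = 0)
    (hB : 0 ≤ qc B) (hB1 : qd B = 0) (h : qb A = 0 → qb B = 0) :
    IsNormalPair (qa A) (qa B) (qa (A * B)) A B := by
  have nA := norm_coords A
  have nB := norm_coords B
  rw [hA1, hA2] at nA
  rw [hB1] at nB
  have h1 : √(1 - qa A ^ 2) = qb A := by
    rw [← Real.sqrt_sq hA]; congr 1; linarith
  have h2 : (qa A * qa B - qa (A * B)) / qb A = qb B := by
    rw [qa_mul, hA1, hA2]
    by_cases h0 : qb A = 0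
    · rw [h h0, h0]; simp
    · field_simp; ring
  refine ⟨rfl, h1.symm, hA1, hA2, rfl, ?_, ?_, hB1⟩
  · rw [h1, h2]
  · rw [h1, h2, ← Real.sqrt_sq hB]; congr 1; linarith

theorem exists_isNormalPair_conj (A B : SU2) : ∃ g : SU2,
    IsNormalPair (qa A) (qa B) (qa (A * B)) (g * A * g⁻¹) (g * B * g⁻¹) := by
  suffices h : ∃ g : SU2, 0 ≤ qb (g * A * g⁻¹) ∧ qc (g * A * g⁻¹) = 0 ∧ qd (g * A * g⁻¹) = 0 ∧
      0 ≤ qc (g * B * g⁻¹) ∧ qd (g * B * g⁻¹) = 0 ∧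
      (qb (g * A * g⁻¹) = 0 → qb (g * B * g⁻¹) = 0) by
    obtain ⟨g, h1, h2, h3, h4, h5, h6⟩ := h
    refine ⟨g, ?_⟩
    have := isNormalPair_of_coords h1 h2 h3 h4 h5 h6
    rwa [qa_conj, qa_conj, show g * A * g⁻¹ * (g * B * g⁻¹) = g * (A * B) * g⁻¹ by group,
      qa_conj] at this
  have nA := norm_coords A
  have nB := norm_coords B
  by_cases h0 : 0 < qb A ^ 2 + qc A ^ 2 + qd A ^ 2
  · set s := √(qb A ^ 2 + qc A ^ 2 + qd A ^ 2) with hs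
    have hs0 : 0 < s := Real.sqrt_pos.2 h0
    have hs2 : s ^ 2 = qb A ^ 2 + qc A ^ 2 + qd A ^ 2 := Real.sq_sqrt h0.le
    let N : SU2 := ofCoords (qa A) s 0 0 (by rw [hs2]; linarith)
    obtain ⟨g, hg⟩ := exists_conj_eq (A := A) N (ofCoords 0 0 1 0 (by norm_num)) rfl rfl
      (by simp [N])
    obtain ⟨k, kc, kd, h1, h2, h3⟩ := exists_conj_halfplane (g * B * g⁻¹)
    -- The second rotation is about the axis of N, so it does not disturb the first normalization.
    have hk : k * N * k⁻¹ = N := by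
      apply conj_eq_of_mul_eq
      exact commute_iff_cross.2 (by simp [kc, kd, N])
    have hA : (k * g) * A * (k * g)⁻¹ = N := by
      rw [← hk, ← hg]; group
    have hB : (k * g) * B * (k * g)⁻¹ = k * (g * B * g⁻¹) * k⁻¹ := by group
    refine ⟨k * g, ?_⟩
    rw [hA, hB]
    exact ⟨hs0.le, rfl, rfl, h2, h3, fun h => absurd h hs0.ne'⟩
  -- Now A is central, so all of `SU2` is free to turn Im B onto the second axis, where `qb`
  -- vanishes.
  · have hb : qb A = 0 := by nlinarith [sq_nonneg (qc A), sq_nonneg (qd A)]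
    have hc : qc A = 0 := by nlinarith [sq_nonneg (qb A), sq_nonneg (qd A)]
    have hd : qd A = 0 := by nlinarith [sq_nonneg (qc A), sq_nonneg (qb A)]
    set s := √(qb B ^ 2 + qc B ^ 2 + qd B ^ 2) with hs
    have hs2 : s ^ 2 = qb B ^ 2 + qc B ^ 2 + qd B ^ 2 := Real.sq_sqrt (by positivity)
    let N : SU2 := ofCoords (qa B) 0 s 0 (by rw [hs2]; linarith)
    obtain ⟨g, hg⟩ := exists_conj_eq (A := B) N (ofCoords 0 1 0 0 (by norm_num)) rfl rfl
      (by simp [N])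
    have hA : g * A * g⁻¹ = A := by
      apply conj_eq_of_mul_eq
      exact commute_iff_cross.2 (by simp [hb, hc, hd])
    refine ⟨g, ?_⟩
    rw [hA, hg]
    exact ⟨hb.ge, hc, hd, Real.sqrt_nonneg _, rfl, fun _ => rfl⟩

/-- Pairs in `SU(2)` are classified up to conjugation by `(Re A, Re B, Re AB)`. -/
theorem exists_conj_pair {A' B' : SU2} (hA : qa A = qa A') (hB : qa B = qa B')
    (hAB : qa (A * B) = qa (A' * B')) : ∃ g : SU2, A' = g * A * g⁻¹ ∧ B' = g * B * g⁻¹ := by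
  obtain ⟨g, hg⟩ := exists_isNormalPair_conj A B
  obtain ⟨k, hk⟩ := exists_isNormalPair_conj A' B'
  rw [hA, hB, hAB] at hg
  obtain ⟨h1, h2⟩ := hg.unique hk
  refine ⟨k⁻¹ * g, ?_, ?_⟩
  · calc A' = k⁻¹ * (k * A' * k⁻¹) * k := by group
      _ = _ := by rw [← h1]; group
  · calc B' = k⁻¹ * (k * B' * k⁻¹) * k := by group
      _ = _ := by rw [← h2]; group

theorem exists_pair {x y z : ℝ} (hx : x ^ 2 ≤ 1) (hy : y ^ 2 ≤ 1)
    (hz : (z - x * y) ^ 2 ≤ (1 - x ^ 2) * (1 - y ^ 2)) :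
    ∃ A B : SU2, qa A = x ∧ qa B = y ∧ qa (A * B) = z := by
  set s := √(1 - x ^ 2) with hs
  have hs2 : s ^ 2 = 1 - x ^ 2 := Real.sq_sqrt (by linarith)
  -- For s = 0 the division returns 0, but the constraint then forces z = xy, so the identity
  -- survives.
  have hsz : s * ((x * y - z) / s) = x * y - z := by
    by_cases h0 : s = 0
    · rw [← hs2, h0] at hz
      have : z - x * y = 0 := pow_eq_zero_iff two_ne_zero |>.1 (by nlinarith)
      rw [h0]; linarith
    · field_simp
  set b := (x * y - z) / s with hb
  have hb2 : b ^ 2 ≤ 1 - y ^ 2 := by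
    by_cases h0 : s = 0
    · rw [hb, h0]; simpa using hy
    · have : 0 < s ^ 2 := by positivity
      refine le_of_mul_le_mul_left ?_ this
      calc s ^ 2 * b ^ 2 = (z - x * y) ^ 2 := by rw [← mul_pow, hsz]; ring
        _ ≤ _ := by rw [hs2]; exact hz
  refine ⟨ofCoords x s 0 0 (by rw [hs2]; ring),
    ofCoords y b (√(1 - y ^ 2 - b ^ 2)) 0
      (by rw [Real.sq_sqrt (by linarith)]; ring), rfl, rfl, ?_⟩
  simp [qa_mul, hsz]

theorem gram_le (A B : SU2) :
    (qa (A * B) - qa A * qa B) ^ 2 ≤ (1 - qa A ^ 2) * (1 - qa B ^ 2) := by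
  nlinarith [gram_identity A B, sq_nonneg (qc A * qd B - qd A * qc B),
    sq_nonneg (qd A * qb B - qb A * qd B), sq_nonneg (qb A * qc B - qc A * qb B)]

theorem qa_sq_le (A : SU2) : qa A ^ 2 ≤ 1 := by
  nlinarith [norm_coords A, sq_nonneg (qb A), sq_nonneg (qc A), sq_nonneg (qd A)]

/-! ### The double covering -/

theorem signSU2_mul_coords (e : ℤˣ) (A : SU2) : qa (signSU2 e * A) = (e : ℤ) * qa A ∧
    qb (signSU2 e * A) = (e : ℤ) * qb A ∧ qc (signSU2 e * A) = (e : ℤ) * qc A ∧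
    qd (signSU2 e * A) = (e : ℤ) * qd A := by
  rcases Int.units_eq_one_or e with rfl | rfl <;>
    simp [qa, qb, qc, qd, signSU2]

theorem covering_signSU2 (e : ℤˣ) : covering (signSU2 e) = 1 := by
  apply Subtype.ext
  obtain ⟨h1, h2, h3, h4⟩ := signSU2_mul_coords e 1
  rw [mul_one] at h1 h2 h3 h4
  rw [covering_coe, h1, h2, h3, h4]
  have : ((e : ℤ) : ℝ) ^ 2 = 1 := by
    rcases Int.units_eq_one_or e with rfl | rfl <;> simp
  ext i j
  fin_cases i <;> fin_cases j <;> simp [qa, qb, qc, qd, this]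

theorem covering_eq_one (h : covering A = 1) : ∃ e : ℤˣ, A = signSU2 e := by
  have hM : (covering A).1 = 1 := by rw [h]; rfl
  rw [covering_coe] at hM
  have h0 := congrFun (congrFun hM 0) 0
  have h1 := congrFun (congrFun hM 1) 1
  have h2 := congrFun (congrFun hM 2) 2
  simp at h0 h1 h2
  have hn := norm_coords A
  have hb : qb A = 0 := by nlinarith [sq_nonneg (qb A)]
  have hc : qc A = 0 := by nlinarith [sq_nonneg (qc A)]
  have hd : qd A = 0 := by nlinarith [sq_nonneg (qd A)]
  rw [hb, hc, hd] at hn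
  rcases mul_self_eq_one_iff.1 (show qa A * qa A = 1 by linarith) with ha | ha
  · refine ⟨1, ext_coords ?_ ?_ ?_ ?_⟩ <;>
      simp [signSU2, ha, hb, hc, hd] <;> simp [qa, qb, qc, qd]
  · refine ⟨-1, ext_coords ?_ ?_ ?_ ?_⟩ <;>
      simp [signSU2, ha, hb, hc, hd] <;> simp [qa, qb, qc, qd]

theorem covering_eq_iff : covering A = covering B ↔ ∃ e : ℤˣ, B = signSU2 e * A := by
  constructor
  · intro h
    obtain ⟨e, he⟩ := covering_eq_one (A := B * A⁻¹) (by rw [map_mul, map_inv, h, mul_inv_cancel])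
    exact ⟨e, by rw [← he]; group⟩
  · rintro ⟨e, rfl⟩
    rw [map_mul, covering_signSU2, one_mul]

/-- `SU2` acts transitively on unit vectors, so R may be composed with an image of `covering` until
it fixes the first basis vector. What remains is a plane rotation, lifted by halving its angle. -/
theorem covering_surjective : Function.Surjective covering := by
  suffices key : ∀ R : SO3, R.1.mulVec ![1, 0, 0] = ![1, 0, 0] → ∃ A, covering A = R by
    intro R
    have hR := (Matrix.mem_specialOrthogonalGroup_iff.1 R.2).1
    have hRR := (Matrix.mem_orthogonalGroup_iff' _ _).1 hR
    set u := R.1.mulVec ![1, 0, 0] with hu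
    have hun : u 0 ^ 2 + u 1 ^ 2 + u 2 ^ 2 = 1 := by
      have := congrFun (congrFun hRR 0) 0
      simp [Matrix.mul_apply, Fin.sum_univ_three] at this
      simp [hu, Matrix.mulVec, dotProduct, Fin.sum_univ_three]
      linarith
    let U : SU2 := ofCoords 0 (u 0) (u 1) (u 2) (by linarith)
    obtain ⟨g, hg⟩ := exists_conj_eq (A := U) (ofCoords 0 1 0 0 (by norm_num))
      (ofCoords 0 0 1 0 (by norm_num)) rfl rfl (by simp)
    have hU : vec U = u := by ext i; fin_cases i <;> rfl
    have h := vec_conj g U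
    rw [hg, hU] at h
    obtain ⟨A, hA⟩ := key (covering g * R) (by
      change ((covering g).1 * R.1).mulVec _ = _
      rw [← Matrix.mulVec_mulVec, ← hu, ← h]
      rfl)
    exact ⟨g⁻¹ * A, by rw [map_mul, hA, map_inv]; group⟩
  intro R hR
  obtain ⟨hO, hdet⟩ := Matrix.mem_specialOrthogonalGroup_iff.1 R.2
  have hO' := (Matrix.mem_orthogonalGroup_iff' _ _).1 hO
  replace hO := (Matrix.mem_orthogonalGroup_iff _ _).1 hO
  have c0 := congrFun hR 0
  have c1 := congrFun hR 1
  have c2 := congrFun hR 2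
  simp [Matrix.mulVec, dotProduct, Fin.sum_univ_three] at c0 c1 c2
  have r00 := congrFun (congrFun hO 0) 0
  have r11 := congrFun (congrFun hO' 1) 1
  have r22 := congrFun (congrFun hO' 2) 2
  simp [Matrix.mul_apply, Fin.sum_univ_three, c0] at r00 r11 r22
  have d01 : R.1 0 1 = 0 := by nlinarith [sq_nonneg (R.1 0 1), sq_nonneg (R.1 0 2)]
  have d02 : R.1 0 2 = 0 := by nlinarith [sq_nonneg (R.1 0 1), sq_nonneg (R.1 0 2)]
  rw [Matrix.det_fin_three] at hdet
  simp [c0, c1, c2, d01, d02] at hdet r11 r22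
  -- The two squares add up to the squared norms of the last two columns minus twice the
  -- determinant, that is 2 − 2 = 0.
  have e1 : R.1 2 2 = R.1 1 1 := by
    nlinarith [sq_nonneg (R.1 2 2 - R.1 1 1), sq_nonneg (R.1 1 2 + R.1 2 1)]
  have e2 : R.1 1 2 = -R.1 2 1 := by
    nlinarith [sq_nonneg (R.1 2 2 - R.1 1 1), sq_nonneg (R.1 1 2 + R.1 2 1)]
  -- The square root of cos θ + i sin θ supplies the half angle.
  obtain ⟨w, hw⟩ := IsAlgClosed.exists_pow_nat_eq (⟨R.1 1 1, R.1 2 1⟩ : ℂ) two_pos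
  have hre := congrArg Complex.re hw
  have him := congrArg Complex.im hw
  simp [pow_two] at hre him
  have hn : w.re ^ 2 + w.im ^ 2 = 1 := by
    have : (w.re ^ 2 + w.im ^ 2) ^ 2 = 1 := by
      calc _ = (w.re * w.re - w.im * w.im) ^ 2 + (w.re * w.im + w.im * w.re) ^ 2 := by ring
        _ = 1 := by rw [hre, him]; linarith
    nlinarith [sq_nonneg w.re, sq_nonneg w.im]
  refine ⟨ofCoords w.re w.im 0 0 (by linarith), Subtype.ext ?_⟩
  rw [covering_coe]
  ext i j
  fin_cases i <;> fin_cases j <;> simp [c0, c1, c2, d01, d02, e1, e2] <;> linarith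

end SU2

/-! ### The convex body of correlation matrices -/

/-- The set of triples `(x, y, z)` of correlations of three vectors. -/
def correlationBody : Set (EuclideanSpace ℝ (Fin 3)) :=
  {p | p 0 ^ 2 ≤ 1 ∧ p 1 ^ 2 ≤ 1 ∧ (p 2 - p 0 * p 1) ^ 2 ≤ (1 - p 0 ^ 2) * (1 - p 1 ^ 2)}

namespace correlationBody

/-- Completing the square in a leaves a binary form in b, c whose discriminant condition is the
third inequality. Each condition on the right is affine in p, which makes convexity immediate. -/
theorem mem_iff_forall_nonneg (p : EuclideanSpace ℝ (Fin 3)) : p ∈ correlationBody ↔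
    ∀ a b c : ℝ, 0 ≤ a ^ 2 + b ^ 2 + c ^ 2 + 2 * (p 0 * a * b + p 1 * a * c + p 2 * b * c) := by
  constructor
  · rintro ⟨hx, hy, hz⟩ a b c
    have key : 0 ≤ (1 - p 0 ^ 2) * b ^ 2 + 2 * (p 2 - p 0 * p 1) * b * c +
        (1 - p 1 ^ 2) * c ^ 2 := by
      rcases hx.lt_or_eq with h | h
      · refine nonneg_of_mul_nonneg_right (a := 1 - p 0 ^ 2) ?_ (by linarith)
        nlinarith [sq_nonneg ((1 - p 0 ^ 2) * b + (p 2 - p 0 * p 1) * c),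
          mul_nonneg (sub_nonneg.2 hz) (sq_nonneg c)]
      · rw [h, sub_self, zero_mul] at hz
        have : p 2 - p 0 * p 1 = 0 := pow_eq_zero_iff two_ne_zero |>.1 (by nlinarith)
        rw [h, this]
        nlinarith [mul_nonneg (sub_nonneg.2 hy) (sq_nonneg c)]
    nlinarith [sq_nonneg (a + p 0 * b + p 1 * c)]
  · intro h
    -- The first argument is always the minimizer a = −(p₀b + p₁c).
    have hx : p 0 ^ 2 ≤ 1 := by nlinarith [h (-p 0) 1 0]
    have hy : p 1 ^ 2 ≤ 1 := by nlinarith [h (-p 1) 0 1]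
    refine ⟨hx, hy, ?_⟩
    have key (b c : ℝ) : 0 ≤ (1 - p 0 ^ 2) * b ^ 2 + 2 * (p 2 - p 0 * p 1) * b * c +
        (1 - p 1 ^ 2) * c ^ 2 := by
      nlinarith [h (-(p 0 * b + p 1 * c)) b c]
    have := discrim_le_zero (a := 1 - p 0 ^ 2) (b := 2 * (p 2 - p 0 * p 1)) (c := 1 - p 1 ^ 2)
      (fun t => by nlinarith [key t 1])
    rw [discrim] at this
    nlinarith

theorem convex : Convex ℝ correlationBody := by
  intro p hp q hq s t hs ht hst
  rw [mem_iff_forall_nonneg] at *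
  intro a b c
  simp only [PiLp.add_apply, PiLp.smul_apply, smul_eq_mul]
  have h1 := mul_nonneg hs (hp a b c)
  have h2 := mul_nonneg ht (hq a b c)
  obtain rfl : t = 1 - s := by linarith
  nlinarith

theorem isClosed : IsClosed correlationBody := by
  have h1 : IsClosed {p : EuclideanSpace ℝ (Fin 3) | p 0 ^ 2 ≤ 1} :=
    isClosed_le (by fun_prop) (by fun_prop)
  have h2 : IsClosed {p : EuclideanSpace ℝ (Fin 3) | p 1 ^ 2 ≤ 1} :=
    isClosed_le (by fun_prop) (by fun_prop)
  have h3 : IsClosed {p : EuclideanSpace ℝ (Fin 3) |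
      (p 2 - p 0 * p 1) ^ 2 ≤ (1 - p 0 ^ 2) * (1 - p 1 ^ 2)} :=
    isClosed_le (by fun_prop) (by fun_prop)
  exact h1.inter (h2.inter h3)

theorem sq_le {p : EuclideanSpace ℝ (Fin 3)} (hp : p ∈ correlationBody) : p 2 ^ 2 ≤ 1 := by
  rw [mem_iff_forall_nonneg] at hp
  nlinarith [hp 0 (-p 2) 1]

theorem isBounded : Bornology.IsBounded correlationBody := by
  refine (Metric.isBounded_closedBall (x := (0 : EuclideanSpace ℝ (Fin 3))) (r := 2)).subset ?_
  intro p hp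
  rw [mem_closedBall_zero_iff, EuclideanSpace.norm_eq, Fin.sum_univ_three,
    Real.sqrt_le_left (by norm_num)]
  simp only [Real.norm_eq_abs, sq_abs]
  linarith [hp.1, hp.2.1, sq_le hp]

/-- Moving the third coordinate by ±ε/2 and adding the two inequalities produces a strict gain of
ε²/4. Conversely, strictness forces x², y² < 1, and strict inequalities are open. -/
theorem mem_interior_iff {p : EuclideanSpace ℝ (Fin 3)} (hp : p ∈ correlationBody) :
    p ∈ interior correlationBody ↔ (p 2 - p 0 * p 1) ^ 2 < (1 - p 0 ^ 2) * (1 - p 1 ^ 2) := by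
  constructor
  · intro h
    have hc : Continuous fun t : ℝ => p + t • EuclideanSpace.single (2 : Fin 3) (1 : ℝ) := by
      fun_prop
    have h0 : ∀ᶠ t in 𝓝 (0 : ℝ), p + t • EuclideanSpace.single 2 (1 : ℝ) ∈ correlationBody :=
      hc.continuousAt.eventually (by simpa using mem_interior_iff_mem_nhds.1 h)
    obtain ⟨ε, hε, hb⟩ := Metric.eventually_nhds_iff_ball.1 h0
    have h1 := (hb (ε / 2) (by simp [abs_of_pos hε, hε])).2.2
    have h2 := (hb (-(ε / 2)) (by simp [abs_of_pos hε, hε])).2.2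
    simp at h1 h2
    nlinarith [sq_pos_of_pos hε]
  · intro h
    have hx : p 0 ^ 2 < 1 := by
      refine hp.1.lt_of_ne fun h' => ?_
      rw [h'] at h
      nlinarith [sq_nonneg (p 2 - p 0 * p 1)]
    have hy : p 1 ^ 2 < 1 := by
      refine hp.2.1.lt_of_ne fun h' => ?_
      rw [h'] at h
      nlinarith [sq_nonneg (p 2 - p 0 * p 1)]
    refine mem_interior.2 ⟨{p | p 0 ^ 2 < 1 ∧ p 1 ^ 2 < 1 ∧
      (p 2 - p 0 * p 1) ^ 2 < (1 - p 0 ^ 2) * (1 - p 1 ^ 2)}, ?_, ?_, hx, hy, h⟩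
    · exact fun q hq => ⟨hq.1.le, hq.2.1.le, hq.2.2.le⟩
    · have h1 : IsOpen {p : EuclideanSpace ℝ (Fin 3) | p 0 ^ 2 < 1} :=
        isOpen_lt (by fun_prop) (by fun_prop)
      have h2 : IsOpen {p : EuclideanSpace ℝ (Fin 3) | p 1 ^ 2 < 1} :=
        isOpen_lt (by fun_prop) (by fun_prop)
      have h3 : IsOpen {p : EuclideanSpace ℝ (Fin 3) |
          (p 2 - p 0 * p 1) ^ 2 < (1 - p 0 ^ 2) * (1 - p 1 ^ 2)} :=
        isOpen_lt (by fun_prop) (by fun_prop)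
      exact h1.inter (h2.inter h3)

theorem mem_frontier_iff {p : EuclideanSpace ℝ (Fin 3)} (hp : p ∈ correlationBody) :
    p ∈ frontier correlationBody ↔ (p 2 - p 0 * p 1) ^ 2 = (1 - p 0 ^ 2) * (1 - p 1 ^ 2) := by
  rw [isClosed.frontier_eq, Set.mem_sdiff, mem_interior_iff hp, not_lt]
  exact ⟨fun h => le_antisymm hp.2.2 h.2, fun h => ⟨hp, h.ge⟩⟩

theorem interior_nonempty : (interior correlationBody).Nonempty :=
  ⟨0, (mem_interior_iff (by simp [correlationBody])).2 (by simp)⟩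

/-- The body of correlations is homeomorphic to the closed ball, with frontier corresponding to
the sphere. -/
theorem exists_homeomorph_closedBall :
    ∃ Φ : correlationBody ≃ₜ Metric.closedBall (0 : EuclideanSpace ℝ (Fin 3)) 1,
      ∀ p : correlationBody, (Φ p : EuclideanSpace ℝ (Fin 3)) ∈ Metric.sphere 0 1 ↔
        p.1 ∈ frontier correlationBody := by
  obtain ⟨h, -, h2, h3⟩ := exists_homeomorph_image_interior_closure_frontier_eq_unitBall convex
    interior_nonempty isBounded
  rw [isClosed.closure_eq] at h2
  refine ⟨(h.image _).trans (Homeomorph.setCongr h2), fun p => ?_⟩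
  rw [← h3]
  exact h.injective.mem_set_image

end correlationBody

/-! ### Complements of coordinate axes -/

/-- The union of the three coordinate axes of `ℝ³`. -/
def coordAxes : Set (EuclideanSpace ℝ (Fin 3)) :=
  {p | (p 0 = 0 ∧ p 1 = 0) ∨ (p 0 = 0 ∧ p 2 = 0) ∨ (p 1 = 0 ∧ p 2 = 0)}

theorem isClosed_coordAxes : IsClosed coordAxes := by
  refine .union (.inter (isClosed_eq ?_ ?_) (isClosed_eq ?_ ?_))
    (.union (.inter (isClosed_eq ?_ ?_) (isClosed_eq ?_ ?_))
      (.inter (isClosed_eq ?_ ?_) (isClosed_eq ?_ ?_))) <;> fun_prop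

/-- The points of the plane through `a` and the coordinate axis on which the `i`-th and
`j`-th coordinates vanish form the complement of a dense open set. -/
theorem dense_planeCompl {i j : Fin 3} (hij : i ≠ j) {a : EuclideanSpace ℝ (Fin 3)}
    (ha : ¬(a i = 0 ∧ a j = 0)) :
    IsOpen {c : EuclideanSpace ℝ (Fin 3) | a i * c j - a j * c i ≠ 0} ∧
    Dense {c : EuclideanSpace ℝ (Fin 3) | a i * c j - a j * c i ≠ 0} := by
  refine ⟨isOpen_ne_fun (by fun_prop) (by fun_prop), ?_⟩
  intro c
  by_cases hc : a i * c j - a j * c i = 0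
  -- The gradient of the linear form c ↦ aᵢcⱼ − aⱼcᵢ: moving along it leaves the plane at once.
  · let v : EuclideanSpace ℝ (Fin 3) :=
      a i • EuclideanSpace.single j (1 : ℝ) - a j • EuclideanSpace.single i (1 : ℝ)
    have hv : Continuous fun t : ℝ => c + t • v := by fun_prop
    have h0 := map_mem_closure hv (s := {0}ᶜ)
      (t := {c : EuclideanSpace ℝ (Fin 3) | a i * c j - a j * c i ≠ 0})
      (dense_compl_singleton (0 : ℝ) 0) ?_
    · simpa using h0
    · intro t ht
      have h : 0 < a i ^ 2 + a j ^ 2 := by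
        by_contra h
        exact ha ⟨by nlinarith [sq_nonneg (a i), sq_nonneg (a j)],
          by nlinarith [sq_nonneg (a i), sq_nonneg (a j)]⟩
      have : a i * (c + t • v) j - a j * (c + t • v) i = t * (a i ^ 2 + a j ^ 2) := by
        simp [v, hij, hij.symm]
        linear_combination hc
      change _ ≠ _
      rw [this]
      exact mul_ne_zero ht h.ne'
  · exact subset_closure hc

/-- A segment from a can meet an axis only if its endpoint lies in the plane spanned by a and that
axis; D avoids the three planes. -/
theorem dense_segmentCompl {a : EuclideanSpace ℝ (Fin 3)} (ha : a ∉ coordAxes) :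
    ∃ D : Set (EuclideanSpace ℝ (Fin 3)), IsOpen D ∧ Dense D ∧
      ∀ c ∈ D, segment ℝ a c ⊆ coordAxesᶜ := by
  simp only [coordAxes, Set.mem_ofPred_eq, not_or] at ha
  obtain ⟨o1, d1⟩ := dense_planeCompl (i := 0) (j := 1) (by decide) ha.1
  obtain ⟨o2, d2⟩ := dense_planeCompl (i := 0) (j := 2) (by decide) ha.2.1
  obtain ⟨o3, d3⟩ := dense_planeCompl (i := 1) (j := 2) (by decide) ha.2.2
  refine ⟨_, o1.inter (o2.inter o3), d1.inter_of_isOpen_left (d2.inter_of_isOpen_left d3 o2) o1, ?_⟩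
  rintro c ⟨h1, h2, h3⟩ p ⟨s, t, hs, ht, hst, rfl⟩ hp
  have key (i j : Fin 3) (hc : a i * c j - a j * c i ≠ 0)
      (hi : s * a i + t * c i = 0) (hj : s * a j + t * c j = 0) : False := by
    have hs0 : s * (a i * c j - a j * c i) = 0 := by linear_combination c j * hi - c i * hj
    have ht0 : t * (a i * c j - a j * c i) = 0 := by linear_combination a i * hj - a j * hi
    have := (mul_eq_zero.1 hs0).resolve_right hc
    have := (mul_eq_zero.1 ht0).resolve_right hc
    linarith
  rcases hp with ⟨hi, hj⟩ | ⟨hi, hj⟩ | ⟨hi, hj⟩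
  · exact key 0 1 h1 hi hj
  · exact key 0 2 h2 hi hj
  · exact key 1 2 h3 hi hj

/-- Removing the coordinate axes from a convex set with nonempty interior leaves a connected set. -/
theorem Convex.isConnected_diff_coordAxes {C : Set (EuclideanSpace ℝ (Fin 3))} (hC : Convex ℝ C)
    (hne : (interior C).Nonempty) : IsConnected (C \ coordAxes) := by
  have join {a c : EuclideanSpace ℝ (Fin 3)} (ha : a ∈ C) (hc : c ∈ C)
      (h : segment ℝ a c ⊆ coordAxesᶜ) : JoinedIn (C \ coordAxes) a c :=
    JoinedIn.of_segment_subset fun p hp => ⟨hC.segment_subset ha hc hp, h hp⟩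
  have bridge {a b : EuclideanSpace ℝ (Fin 3)} (ha : a ∉ coordAxes) (hb : b ∉ coordAxes) :
      ∃ c ∈ C, segment ℝ a c ⊆ coordAxesᶜ ∧ segment ℝ b c ⊆ coordAxesᶜ := by
    obtain ⟨D, oD, dD, hD⟩ := dense_segmentCompl ha
    obtain ⟨E, oE, dE, hE⟩ := dense_segmentCompl hb
    obtain ⟨c, hc, hcD, hcE⟩ :=
      (dD.inter_of_isOpen_left dE oD).inter_open_nonempty _ isOpen_interior hne
    exact ⟨c, interior_subset hc, hD c hcD, hE c hcE⟩
  -- This point need not lie in C; it only serves to produce, through `bridge`, a point of C off the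
  -- axes.
  have h1 : !₂[(1 : ℝ), 1, 1] ∉ coordAxes := by simp [coordAxes]
  obtain ⟨c, hc, hsc, -⟩ := bridge h1 h1
  refine IsPathConnected.isConnected (isPathConnected_iff.2 ⟨⟨c, hc, ?_⟩, ?_⟩)
  · exact hsc (right_mem_segment ℝ _ _)
  · rintro a ⟨ha, ha'⟩ b ⟨hb, hb'⟩
    obtain ⟨c, hc, hac, hbc⟩ := bridge ha' hb'
    exact (join ha hc hac).trans (join hb hc hbc).symm

/-- Balls intersected with the body are convex, and have interior even at frontier points, since the
body lies in the closure of its interior. -/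
theorem correlationBody.locallyNonseparating_coordAxes :
    LocallyNonseparating (Subtype.val ⁻¹' coordAxes : Set correlationBody) := by
  refine ⟨isClosed_coordAxes.preimage continuous_subtype_val, ?_⟩
  rintro x U hU
  obtain ⟨r, hr, hrU⟩ := Metric.mem_nhds_iff.1 hU
  refine ⟨Metric.ball x r, Metric.ball_mem_nhds x hr, hrU, ?_⟩
  have hint : (interior (Metric.ball x.1 r ∩ correlationBody)).Nonempty := by
    rw [interior_inter, Metric.isOpen_ball.interior_eq]
    have hx : x.1 ∈ closure (interior correlationBody) := by
      rw [correlationBody.convex.closure_interior_eq_closure_of_nonempty_interior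
        correlationBody.interior_nonempty]
      exact subset_closure x.2
    exact mem_closure_iff.1 hx _ Metric.isOpen_ball (Metric.mem_ball_self hr)
  have h := ((convex_ball x.1 r).inter correlationBody.convex).isConnected_diff_coordAxes hint
  have heq : (Metric.ball x.1 r ∩ correlationBody) \ coordAxes =
      Subtype.val '' (Metric.ball x r \ (Subtype.val ⁻¹' coordAxes : Set correlationBody)) := by
    ext p
    constructor
    · rintro ⟨⟨hp, hpK⟩, hpa⟩
      exact ⟨⟨p, hpK⟩, ⟨hp, hpa⟩, rfl⟩
    · rintro ⟨q, ⟨hq, hqa⟩, rfl⟩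
      exact ⟨⟨hq, q.2⟩, hqa⟩
  rw [heq] at h
  exact ⟨h.nonempty.of_image, IsInducing.subtypeVal.isPreconnected_image.1 h.isPreconnected⟩

/-! ### Representation spaces and character spaces -/

namespace RepSpace

variable {G : Type*} [Group G]

/-- The representation with given values on the generators. -/
def ofGens (x : Fin 2 → G) : RepSpace G := (FreeGroup.lift x : F2 →* G)

@[simp] theorem gens_ofGens (x : Fin 2 → G) : (ofGens x).gens = x :=
  funext fun _ => FreeGroup.lift_apply_of

theorem ext_gens {ρ σ : RepSpace G} (h : ρ.gens = σ.gens) : ρ = σ :=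
  FreeGroup.ext_hom ρ.hom σ.hom fun i => congrFun h i

theorem gens_signTwist (e : KleinV) (ρ : RepSpace SU2) (i : Fin 2) :
    (signTwist e ρ).gens i = signSU2 (e i) * ρ.gens i :=
  FreeGroup.lift_apply_of

theorem continuous_gens [TopologicalSpace G] : Continuous (gens : RepSpace G → Fin 2 → G) :=
  continuous_induced_dom

/-- Evaluation on the generators identifies `Hom(F₂, G)` with `G²`. -/
def gensHomeomorph (G : Type*) [Group G] [TopologicalSpace G] : RepSpace G ≃ₜ (Fin 2 → G) where
  toFun := gens
  invFun := ofGens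
  left_inv _ := ext_gens (gens_ofGens _)
  right_inv := gens_ofGens
  continuous_toFun := continuous_gens
  continuous_invFun := continuous_induced_rng.2 (by
    rw [show gens ∘ ofGens = (id : (Fin 2 → G) → _) from funext gens_ofGens]
    exact continuous_id)

/-- A representation takes values in a subgroup as soon as the generators do. -/
theorem hom_mem_of_gens {ρ : RepSpace G} (H : Subgroup G) (h : ∀ i, ρ.gens i ∈ H) (w : F2) :
    ρ.hom w ∈ H := by
  induction w using FreeGroup.induction_on with
  | C1 => rw [map_one]; exact H.one_mem
  | of i => exact h i
  | inv_of i hi => rw [map_inv]; exact H.inv_mem hi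
  | mul x y hx hy => rw [map_mul]; exact H.mul_mem hx hy

/-- Centralizers are subgroups: one application extends commutation from generators to one arbitrary
word, a second to both. -/
theorem forall_commute_iff {ρ : RepSpace G} :
    (∀ v w : F2, Commute (ρ.hom v) (ρ.hom w)) ↔ Commute (ρ.gens 0) (ρ.gens 1) := by
  refine ⟨fun h => h _ _, fun h => ?_⟩
  have h1 (i j : Fin 2) : Commute (ρ.gens i) (ρ.gens j) := by
    fin_cases i <;> fin_cases j
    exacts [.refl _, h, h.symm, .refl _]
  have h2 (i : Fin 2) (w : F2) : Commute (ρ.gens i) (ρ.hom w) :=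
    (Subgroup.mem_centralizer_singleton_iff.1 (hom_mem_of_gens
      (Subgroup.centralizer {ρ.gens i}) (fun j =>
        Subgroup.mem_centralizer_singleton_iff.2 (h1 i j).symm.eq) w) : _ = _).symm
  intro v w
  exact (Subgroup.mem_centralizer_singleton_iff.1 (hom_mem_of_gens
    (Subgroup.centralizer {ρ.hom w}) (fun j =>
      Subgroup.mem_centralizer_singleton_iff.2 (h2 j w).eq) v))

/-- Composition with the covering `SU(2) → SO(3)`. -/
def toSO3 (ρ : RepSpace SU2) : RepSpace SO3 := (covering.comp ρ.hom : F2 →* SO3)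

end RepSpace

namespace CharSpace

variable {G : Type*} [Group G]

theorem mk_surjective : Function.Surjective (mk : RepSpace G → CharSpace G) :=
  Quotient.mk_surjective

theorem isQuotientMap_mk [TopologicalSpace G] : IsQuotientMap (mk : RepSpace G → CharSpace G) :=
  isQuotientMap_quotient_mk'

theorem mk_eq_mk_iff {ρ σ : RepSpace G} :
    mk ρ = mk σ ↔ ∃ g : G, ∀ i, σ.gens i = g * ρ.gens i * g⁻¹ := by
  refine Quotient.eq.trans ⟨fun ⟨g, hg⟩ => ⟨g, fun i => hg _⟩, fun ⟨g, hg⟩ => ⟨g, fun w => ?_⟩⟩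
  have h : σ.hom = (MulAut.conj g).toMonoidHom.comp ρ.hom := FreeGroup.ext_hom _ _ hg
  rw [h]
  rfl

end CharSpace

theorem toSO3Char_mk (ρ : RepSpace SU2) : toSO3Char (.mk ρ) = .mk ρ.toSO3 := rfl

theorem smul_mk (e : KleinV) (ρ : RepSpace SU2) :
    e • CharSpace.mk ρ = CharSpace.mk (signTwist e ρ) := rfl

/-! ### Topology of `SU(2)` and the covering -/

namespace SU2

@[fun_prop] theorem continuous_qa : Continuous qa :=
  Complex.continuous_re.comp (continuous_subtype_val.matrix_elem 0 0)
@[fun_prop] theorem continuous_qb : Continuous qb :=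
  Complex.continuous_im.comp (continuous_subtype_val.matrix_elem 0 0)
@[fun_prop] theorem continuous_qc : Continuous qc :=
  Complex.continuous_re.comp (continuous_subtype_val.matrix_elem 0 1)
@[fun_prop] theorem continuous_qd : Continuous qd :=
  Complex.continuous_im.comp (continuous_subtype_val.matrix_elem 0 1)

instance : CompactSpace SU2 := by
  suffices h : IsCompact (Matrix.specialUnitaryGroup (Fin 2) ℂ : Set (Matrix (Fin 2) (Fin 2) ℂ)) from
    isCompact_iff_compactSpace.1 h
  have hc : IsCompact (Set.univ.pi fun _ : Fin 2 => Set.univ.pi fun _ : Fin 2 =>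
      Metric.closedBall (0 : ℂ) 1) :=
    isCompact_univ_pi fun _ => isCompact_univ_pi fun _ => isCompact_closedBall _ _
  refine hc.of_isClosed_subset ?_ ?_
  · have : (Matrix.specialUnitaryGroup (Fin 2) ℂ : Set (Matrix (Fin 2) (Fin 2) ℂ)) =
        {M | M * star M = 1} ∩ {M | M.det = 1} := by
      ext M
      rw [SetLike.mem_coe, Matrix.mem_specialUnitaryGroup_iff, Matrix.mem_unitaryGroup_iff]
      rfl
    rw [this]
    have h1 : IsClosed {M : Matrix (Fin 2) (Fin 2) ℂ | M * star M = 1} :=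
      isClosed_eq (continuous_id.matrix_mul continuous_id.matrix_conjTranspose) continuous_const
    exact h1.inter (isClosed_eq continuous_id.matrix_det continuous_const)
  · intro M hM i _ j _
    rw [mem_closedBall_zero_iff]
    exact entry_norm_bound_of_unitary (Matrix.mem_specialUnitaryGroup_iff.1 hM).1 i j

theorem continuous_covering : Continuous covering := by
  refine continuous_induced_rng.2 (continuous_matrix fun i j => ?_)
  simp only [Function.comp_apply, covering_coe]
  fin_cases i <;> fin_cases j <;> simp <;> fun_prop

end SU2

namespace RepSpace

instance : CompactSpace (RepSpace SU2) := (gensHomeomorph SU2).symm.compactSpace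

instance : T2Space (RepSpace SO3) := (gensHomeomorph SO3).symm.t2Space

theorem continuous_toSO3 : Continuous toSO3 :=
  continuous_induced_rng.2 (continuous_pi fun i =>
    SU2.continuous_covering.comp ((continuous_apply i).comp continuous_gens))

/-- Freeness is essential: the generators are lifted independently, with no relation to preserve. -/
theorem toSO3_surjective : Function.Surjective toSO3 := by
  intro ρ
  choose f hf using SU2.covering_surjective
  exact ⟨ofGens fun i => f (ρ.gens i), ext_gens (funext fun i =>
    (congrArg covering (congrFun (gens_ofGens _) i)).trans (hf _))⟩

end RepSpace

/-- The natural map of character spaces is a quotient map. -/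
theorem isQuotientMap_toSO3Char : IsQuotientMap toSO3Char := by
  -- On representation spaces the map goes from a compact space to a Hausdorff one, hence is closed;
  -- separation of the `SO3` character space is not needed.
  have h1 : IsQuotientMap (CharSpace.mk ∘ RepSpace.toSO3) :=
    CharSpace.isQuotientMap_mk.comp (RepSpace.continuous_toSO3.isClosedMap.isQuotientMap
      RepSpace.continuous_toSO3 RepSpace.toSO3_surjective)
  refine CharSpace.isQuotientMap_mk.of_comp_isQuotientMap (g := toSO3Char) ?_
  exact h1

/-- A conjugating rotation lifts to `SU2`, after which the generators differ by elements of the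
kernel ±1. These are central, so the signs pass through conjugation. -/
theorem toSO3Char_eq_iff (χ χ' : CharSpace SU2) :
    toSO3Char χ = toSO3Char χ' ↔ χ' ∈ MulAction.orbit KleinV χ := by
  obtain ⟨ρ, rfl⟩ := CharSpace.mk_surjective χ
  obtain ⟨σ, rfl⟩ := CharSpace.mk_surjective χ'
  rw [toSO3Char_mk, toSO3Char_mk, CharSpace.mk_eq_mk_iff]
  constructor
  · rintro ⟨R, hR⟩
    obtain ⟨g, rfl⟩ := SU2.covering_surjective R
    have h (i : Fin 2) : ∃ e : ℤˣ, σ.gens i = signSU2 e * (g * ρ.gens i * g⁻¹) := by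
      rw [← SU2.covering_eq_iff, map_mul, map_mul, map_inv]
      exact (hR i).symm
    choose e he using h
    refine ⟨e, (smul_mk e ρ).trans (CharSpace.mk_eq_mk_iff.2 ⟨g, fun i => ?_⟩)⟩
    rw [he, RepSpace.gens_signTwist, ← mul_assoc g, ← signSU2_comm]
    group
  · rintro ⟨e, he⟩
    obtain ⟨g, hg⟩ := CharSpace.mk_eq_mk_iff.1 ((smul_mk e ρ).symm.trans he)
    refine ⟨covering g, fun i => ?_⟩
    change covering (σ.gens i) = covering g * covering (ρ.gens i) * (covering g)⁻¹
    rw [hg, RepSpace.gens_signTwist, map_mul, map_mul, map_mul, map_inv, SU2.covering_signSU2,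
      one_mul]

/-! ### The character space as a convex body -/

/-- The traces `(tr A, tr B, tr AB) / 2` of a representation. -/
noncomputable def RepSpace.traces (ρ : RepSpace SU2) : correlationBody :=
  ⟨!₂[SU2.qa (ρ.gens 0), SU2.qa (ρ.gens 1), SU2.qa (ρ.gens 0 * ρ.gens 1)],
    SU2.qa_sq_le _, SU2.qa_sq_le _, SU2.gram_le _ _⟩

theorem RepSpace.continuous_traces : Continuous RepSpace.traces := by
  have h (i : Fin 2) : Continuous fun ρ : RepSpace SU2 => ρ.gens i :=
    (continuous_apply i).comp continuous_gens
  have h0 := h 0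
  have h1 := h 1
  refine continuous_induced_rng.2 ((PiLp.continuous_toLp 2 _).comp (continuous_pi fun i => ?_))
  fin_cases i
  · exact SU2.continuous_qa.comp h0
  · exact SU2.continuous_qa.comp h1
  · simp [SU2.qa_mul]
    fun_prop

namespace CharSpace

theorem traces_eq_iff {ρ σ : RepSpace SU2} : ρ.traces = σ.traces ↔ mk ρ = mk σ := by
  rw [mk_eq_mk_iff]
  constructor
  · intro h
    have hv := congrArg Subtype.val h
    obtain ⟨g, h0, h1⟩ := SU2.exists_conj_pair (congrFun (congrArg WithLp.ofLp hv) 0)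
      (congrFun (congrArg WithLp.ofLp hv) 1) (congrFun (congrArg WithLp.ofLp hv) 2)
    exact ⟨g, Fin.forall_fin_two.2 ⟨h0, h1⟩⟩
  · rintro ⟨g, hg⟩
    have h : g * ρ.gens 0 * g⁻¹ * (g * ρ.gens 1 * g⁻¹) = g * (ρ.gens 0 * ρ.gens 1) * g⁻¹ := by
      group
    apply Subtype.ext
    simp only [RepSpace.traces, hg, h, SU2.qa_conj]

/-- The trace coordinates of a character. -/
noncomputable def traces : CharSpace SU2 → correlationBody :=
  Quotient.lift RepSpace.traces fun _ _ h => traces_eq_iff.2 (Quotient.sound h)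

theorem traces_mk (ρ : RepSpace SU2) : traces (mk ρ) = ρ.traces := rfl

theorem continuous_traces : Continuous traces :=
  RepSpace.continuous_traces.quotient_lift _

theorem traces_bijective : Function.Bijective traces := by
  constructor
  · intro χ χ' h
    obtain ⟨ρ, rfl⟩ := mk_surjective χ
    obtain ⟨σ, rfl⟩ := mk_surjective χ'
    exact traces_eq_iff.1 h
  · rintro ⟨p, hx, hy, hz⟩
    obtain ⟨A, B, hA, hB, hAB⟩ := SU2.exists_pair hx hy hz
    refine ⟨mk (RepSpace.ofGens ![A, B]), Subtype.ext ?_⟩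
    ext i
    fin_cases i <;> simp [traces_mk, RepSpace.traces, hA, hB, hAB]

instance : CompactSpace (CharSpace SU2) := inferInstanceAs (CompactSpace (Quotient _))

/-- The trace coordinates identify the `SU(2)`-character space with a convex body. -/
noncomputable def tracesHomeomorph : CharSpace SU2 ≃ₜ correlationBody :=
  Continuous.homeoOfEquivCompactToT2 (f := Equiv.ofBijective traces traces_bijective)
    continuous_traces

instance : T2Space (CharSpace SU2) := tracesHomeomorph.symm.t2Space

theorem traces_smul (e : KleinV) (χ : CharSpace SU2) :
    (traces (e • χ)).1 = !₂[((e 0 : ℤ) : ℝ) * (traces χ).1 0, ((e 1 : ℤ) : ℝ) * (traces χ).1 1,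
      ((e 0 : ℤ) : ℝ) * ((e 1 : ℤ) : ℝ) * (traces χ).1 2] := by
  obtain ⟨ρ, rfl⟩ := mk_surjective χ
  have h : signSU2 (e 0) * ρ.gens 0 * (signSU2 (e 1) * ρ.gens 1) =
      signSU2 (e 0) * (signSU2 (e 1) * (ρ.gens 0 * ρ.gens 1)) := by
    rw [mul_assoc, ← mul_assoc (ρ.gens 0), ← signSU2_comm, mul_assoc]
  rw [smul_mk, traces_mk, traces_mk]
  ext i
  fin_cases i <;> simp [RepSpace.traces, RepSpace.gens_signTwist, SU2.signSU2_mul_coords, h,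
    mul_assoc]

instance : ContinuousConstSMul KleinV (CharSpace SU2) where
  continuous_const_smul e := by
    refine isQuotientMap_mk.continuous_iff.2 ?_
    have h : Continuous (signTwist e) := by
      refine continuous_induced_rng.2 (continuous_pi fun i => ?_)
      simp only [Function.comp_apply, RepSpace.gens_signTwist]
      exact ((continuous_apply i).comp RepSpace.continuous_gens).const_mul _
    exact isQuotientMap_mk.continuous.comp h

theorem isAbelian_mk_iff (ρ : RepSpace SU2) :
    (mk ρ).IsAbelian ↔ Commute (ρ.gens 0) (ρ.gens 1) := by
  constructor
  · rintro ⟨σ, h, hσ⟩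
    obtain ⟨g, hg⟩ := mk_eq_mk_iff.1 h
    have := (RepSpace.forall_commute_iff.1 hσ).map (MulAut.conj g)
    simpa [hg] using this
  · exact fun h => ⟨ρ, rfl, RepSpace.forall_commute_iff.2 h⟩

/-- If R conjugates one representation to another, it carries the axis v to Rv. The rotations fixing
v form a subgroup, so the generators suffice. -/
theorem hasCommonAxis_mk_iff (ρ : RepSpace SU2) :
    HasCommonAxis (toSO3Char (mk ρ)) ↔ Commute (ρ.gens 0) (ρ.gens 1) := by
  rw [SU2.commute_iff_exists_axis]
  constructor
  · rintro ⟨σ, h, v, hv, hσ⟩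
    obtain ⟨R, hR⟩ := mk_eq_mk_iff.1 h
    have hinv : (R⁻¹).1.mulVec (R.1.mulVec v) = v := by
      rw [Matrix.mulVec_mulVec]
      have : (R⁻¹).1 * R.1 = 1 := congrArg Subtype.val (inv_mul_cancel R)
      rw [this, Matrix.one_mulVec]
    have key (i : Fin 2) : (covering (ρ.gens i)).1.mulVec (R.1.mulVec v) = R.1.mulVec v := by
      have h1 : (covering (ρ.gens i)) = R * σ.gens i * R⁻¹ := hR i
      rw [h1]
      change (R.1 * (σ.gens i).1 * (R⁻¹).1).mulVec _ = _
      rw [← Matrix.mulVec_mulVec, hinv, ← Matrix.mulVec_mulVec]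
      exact congrArg _ (hσ _)
    refine ⟨R.1.mulVec v, fun h0 => hv ?_, key 0, key 1⟩
    rw [← hinv, h0, Matrix.mulVec_zero]
  · rintro ⟨v, hv, h0, h1⟩
    refine ⟨ρ.toSO3, rfl, v, hv, ?_⟩
    let H : Subgroup SO3 :=
      { carrier := {R | R.1.mulVec v = v}
        one_mem' := Matrix.one_mulVec v
        mul_mem' := fun {R S} hR hS => by
          change (R.1 * S.1).mulVec v = v
          rw [← Matrix.mulVec_mulVec, show S.1.mulVec v = v from hS]
          exact hR
        inv_mem' := fun {R} hR => by
          have h : (R⁻¹).1 * R.1 = 1 := congrArg Subtype.val (inv_mul_cancel R)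
          change (R⁻¹).1.mulVec v = v
          conv_lhs => rw [← show R.1.mulVec v = v from hR]
          rw [Matrix.mulVec_mulVec, h, Matrix.one_mulVec] }
    exact RepSpace.hom_mem_of_gens H (Fin.forall_fin_two.2 ⟨h0, h1⟩)

/-- Both sides are equality in the Gram inequality. -/
theorem traces_mem_frontier_iff (ρ : RepSpace SU2) :
    (traces (mk ρ)).1 ∈ frontier correlationBody ↔ Commute (ρ.gens 0) (ρ.gens 1) := by
  rw [correlationBody.mem_frontier_iff (traces (mk ρ)).2, SU2.commute_iff_gram]
  rfl

end CharSpace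

/-! ### The branched covering -/

section FiniteQuotient

variable {X Y Γ : Type*} [Group Γ] [MulAction Γ X] {p : X → Y}

/-- Saturations are unions of translates, which are open for open s, and closed for closed s when
the group is finite. -/
theorem preimage_image_eq_iUnion_smul (hp : ∀ x x', p x = p x' ↔ x' ∈ MulAction.orbit Γ x)
    (s : Set X) : p ⁻¹' (p '' s) = ⋃ g : Γ, (fun x => g • x) '' s := by
  ext x
  simp only [Set.mem_preimage, Set.mem_image, Set.mem_iUnion]
  constructor
  · rintro ⟨y, hy, h⟩
    obtain ⟨g, hg⟩ := (hp _ _).1 h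
    exact ⟨g, y, hy, hg⟩
  · rintro ⟨g, y, hy, h⟩
    exact ⟨y, hy, (hp _ _).2 ⟨g, h⟩⟩

theorem preimage_singleton_eq_orbit (hp : ∀ x x', p x = p x' ↔ x' ∈ MulAction.orbit Γ x) (x : X) :
    p ⁻¹' {p x} = MulAction.orbit Γ x := by
  ext x'
  rw [← hp, Set.mem_preimage, Set.mem_singleton_iff, eq_comm]

variable [TopologicalSpace X] [TopologicalSpace Y] [ContinuousConstSMul Γ X]

theorem Topology.IsQuotientMap.isOpenMap_of_orbits (hq : IsQuotientMap p)
    (hp : ∀ x x', p x = p x' ↔ x' ∈ MulAction.orbit Γ x) : IsOpenMap p := by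
  intro s hs
  rw [← hq.isOpen_preimage, preimage_image_eq_iUnion_smul hp]
  exact isOpen_iUnion fun g => isOpenMap_smul g s hs

theorem Topology.IsQuotientMap.isClosedMap_of_orbits [Finite Γ] (hq : IsQuotientMap p)
    (hp : ∀ x x', p x = p x' ↔ x' ∈ MulAction.orbit Γ x) : IsClosedMap p := by
  intro s hs
  rw [← hq.isClosed_preimage, preimage_image_eq_iUnion_smul hp]
  exact isClosed_iUnion_of_finite fun g => isClosedMap_smul g s hs

end FiniteQuotient

/-- Local non-separation descends along an open quotient map. -/
theorem LocallyNonseparating.of_preimage {X Y : Type*} [TopologicalSpace X] [TopologicalSpace Y]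
    {p : X → Y} {L : Set Y} (hq : IsQuotientMap p) (ho : IsOpenMap p)
    (h : LocallyNonseparating (p ⁻¹' L)) : LocallyNonseparating L := by
  refine ⟨hq.isClosed_preimage.1 h.1, fun y U hU => ?_⟩
  obtain ⟨x, rfl⟩ := hq.surjective y
  obtain ⟨W, hW, hWU, hc⟩ := h.2 x (p ⁻¹' U) (hq.continuous.continuousAt hU)
  refine ⟨p '' W, ho.image_mem_nhds hW, Set.image_subset_iff.2 hWU, ?_⟩
  have : p '' W \ L = p '' (W \ p ⁻¹' L) := by
    rw [Set.image_sdiff_preimage]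
  rw [this]
  exact hc.image p hq.continuous.continuousOn

/-- Local non-separation is invariant under homeomorphisms. -/
theorem LocallyNonseparating.preimage_homeomorph {X Y : Type*} [TopologicalSpace X]
    [TopologicalSpace Y] (e : X ≃ₜ Y) {L : Set Y} (h : LocallyNonseparating L) :
    LocallyNonseparating (e ⁻¹' L) := by
  refine .of_preimage e.symm.isQuotientMap e.symm.isOpenMap ?_
  rw [← Set.preimage_comp, e.self_comp_symm, Set.preimage_id]
  exact h

/-! ### Stabilizers and the branch locus. -/

namespace CharSpace

/-- Each nontrivial pair of signs negates exactly two trace coordinates, so its fixed points are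
those on one coordinate axis. -/
theorem stabilizer_eq_bot_iff (χ : CharSpace SU2) :
    MulAction.stabilizer KleinV χ = ⊥ ↔ (traces χ).1 ∉ coordAxes := by
  have hfix (e : KleinV) : e • χ = χ ↔ ((e 0 : ℤ) : ℝ) * (traces χ).1 0 = (traces χ).1 0 ∧
      ((e 1 : ℤ) : ℝ) * (traces χ).1 1 = (traces χ).1 1 ∧
      ((e 0 : ℤ) : ℝ) * ((e 1 : ℤ) : ℝ) * (traces χ).1 2 = (traces χ).1 2 := by
    rw [← traces_bijective.1.eq_iff, Subtype.ext_iff, traces_smul]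
    constructor
    · intro h
      exact ⟨congrFun (congrArg WithLp.ofLp h) 0, congrFun (congrArg WithLp.ofLp h) 1,
        congrFun (congrArg WithLp.ofLp h) 2⟩
    · rintro ⟨h0, h1, h2⟩
      ext i
      fin_cases i
      exacts [h0, h1, h2]
  have neg_fix (t : ℝ) : -t = t ↔ t = 0 := neg_eq_self
  rw [Subgroup.eq_bot_iff_forall]
  constructor
  · intro h hmem
    have h' (e : KleinV) (he : e • χ = χ) : e = 1 := h e he
    rcases hmem with ⟨h0, h1⟩ | ⟨h0, h1⟩ | ⟨h0, h1⟩
    · exact absurd (h' ![-1, -1] ((hfix _).2 (by simp [h0, h1]))) (by decide)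
    · exact absurd (h' ![-1, 1] ((hfix _).2 (by simp [h0, h1]))) (by decide)
    · exact absurd (h' ![1, -1] ((hfix _).2 (by simp [h0, h1]))) (by decide)
  · intro h e he
    obtain ⟨h0, h1, h2⟩ := (hfix e).1 he
    simp only [coordAxes, Set.mem_ofPred_eq, not_or] at h
    rcases Int.units_eq_one_or (e 0) with e0 | e0 <;>
      rcases Int.units_eq_one_or (e 1) with e1 | e1 <;>
      simp [e0, e1, neg_fix] at h0 h1 h2
    · exact funext (Fin.forall_fin_two.2 ⟨e0, e1⟩)
    · exact absurd ⟨h1, h2⟩ h.2.2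
    · exact absurd ⟨h0, h2⟩ h.2.1
    · exact absurd ⟨h0, h1⟩ h.1

theorem card_kleinV : Nat.card KleinV = 4 := by simp

theorem encard_fiber_le (χ : CharSpace SU2) : (toSO3Char ⁻¹' {toSO3Char χ}).encard ≤ 4 := by
  rw [preimage_singleton_eq_orbit toSO3Char_eq_iff]
  calc (MulAction.orbit KleinV χ).encard ≤ (Set.univ : Set KleinV).encard := by
        rw [MulAction.orbit, ← Set.image_univ]
        exact Set.encard_image_le _ _
    _ = 4 := by simp [Set.encard_univ]

/-- Fibres are orbits, and by orbit–stabilizer an orbit has four points exactly when the stabilizer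
is trivial. -/
theorem mem_branchLocus_iff (χ : CharSpace SU2) :
    toSO3Char χ ∈ branchLocus 4 toSO3Char ↔ (traces χ).1 ∈ coordAxes := by
  rw [← not_iff_not, ← stabilizer_eq_bot_iff]
  change ¬ ((toSO3Char ⁻¹' {toSO3Char χ}).encard < (4 : ℕ)) ↔ _
  have hcard := (MulAction.stabilizer KleinV χ).card_mul_index
  rw [MulAction.index_stabilizer, card_kleinV] at hcard
  have hfin : (MulAction.orbit KleinV χ).Finite := Set.finite_range _
  rw [preimage_singleton_eq_orbit toSO3Char_eq_iff, ← hfin.cast_ncard_eq, Nat.cast_lt, not_lt,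
    Subgroup.eq_bot_iff_card]
  constructor
  · intro h
    have := Nat.card_pos (α := MulAction.stabilizer KleinV χ)
    nlinarith
  · intro h
    rw [h, one_mul] at hcard
    exact hcard.ge

theorem preimage_branchLocus :
    toSO3Char ⁻¹' branchLocus 4 toSO3Char = tracesHomeomorph ⁻¹' (Subtype.val ⁻¹' coordAxes) :=
  Set.ext mem_branchLocus_iff

end CharSpace

theorem isBranchedCovering_toSO3Char : IsBranchedCovering 4 toSO3Char := by
  have hq := isQuotientMap_toSO3Char
  have ho := hq.isOpenMap_of_orbits toSO3Char_eq_iff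
  have hL : LocallyNonseparating (toSO3Char ⁻¹' branchLocus 4 toSO3Char) := by
    rw [CharSpace.preimage_branchLocus]
    exact correlationBody.locallyNonseparating_coordAxes.preimage_homeomorph _
  refine ⟨hq.continuous, hq.surjective, ho, hq.isClosedMap_of_orbits toSO3Char_eq_iff, ?_, ?_,
    .of_preimage hq ho hL, hL⟩
  · intro y
    obtain ⟨χ, rfl⟩ := hq.surjective y
    exact CharSpace.encard_fiber_le χ
  -- The finite group acts properly discontinuously, so the quotient is a covering over the images
  -- of points with trivial stabilizer.
  · refine (hq.isCoveringMapOn_of_properlyDiscontinuousSMul (G := KleinV) ?_).mono ?_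
    · intro χ χ'
      rw [toSO3Char_eq_iff, MulAction.mem_orbit_symm]
    · intro y hy
      obtain ⟨χ, rfl⟩ := hq.surjective y
      exact ⟨χ, (CharSpace.stabilizer_eq_bot_iff χ).2
        ((CharSpace.mem_branchLocus_iff χ).not.1 hy), rfl⟩

theorem mainTheorem12 :
    (∃ Φ : CharSpace SU2 ≃ₜ Metric.closedBall (0 : EuclideanSpace ℝ (Fin 3)) 1,
      ∀ χ : CharSpace SU2,
        ((Φ χ : EuclideanSpace ℝ (Fin 3)) ∈ Metric.sphere (0 : EuclideanSpace ℝ (Fin 3)) 1 ↔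
          χ.IsAbelian) ∧
        ((Φ χ : EuclideanSpace ℝ (Fin 3)) ∈ Metric.sphere (0 : EuclideanSpace ℝ (Fin 3)) 1 ↔
          HasCommonAxis (toSO3Char χ))) ∧
    IsBranchedCovering 4 toSO3Char ∧
    ContinuousConstSMul KleinV (CharSpace SU2) ∧
    (∀ χ χ' : CharSpace SU2,
      toSO3Char χ = toSO3Char χ' ↔ χ' ∈ MulAction.orbit KleinV χ) := by
  refine ⟨?_, isBranchedCovering_toSO3Char, inferInstance, toSO3Char_eq_iff⟩
  obtain ⟨Φ, hΦ⟩ := correlationBody.exists_homeomorph_closedBall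
  refine ⟨CharSpace.tracesHomeomorph.trans Φ, fun χ => ?_⟩
  obtain ⟨ρ, rfl⟩ := CharSpace.mk_surjective χ
  rw [CharSpace.isAbelian_mk_iff, CharSpace.hasCommonAxis_mk_iff]
  have h := (hΦ (CharSpace.tracesHomeomorph (.mk ρ))).trans (CharSpace.traces_mem_frontier_iff ρ)
  exact ⟨h, h⟩
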